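/- Let $\mathcal M$ be a finite-dimensional von Neumann algebra with a normal semifinite faithful trace $\tau$ and $\dim_{\mathbb C}\mathcal M\ge 2$. For $0<p<\infty$ let $L_p(\mathcal M)$ be the vector space $\mathcal M$ with the quasi-norm $\|x\|_p=\tau(|x|^p)^{1/p}$, where $|x|=(x^*x)^{1/2}$. For an integer $m\ge 2$ and $0<q\le\infty$ let $S_q^m$ be the space $B(\ell_2^m)$ of complex $m\times m$ matrices with the Schatten quasi-norm $\|x\|_q=\mathrm{Tr}(|x|^q)^{1/q}$ for $q<\infty$, and with the operator norm for $q=\infty$. An isometric embedding is a $\mathbb C$-linear map $T$ with $\|Tx\|_p=\|x\|_q$ for all $x$. Let $0<p<1$ and $m\ge 2$. Then: 1. for every $q\in(0,2)\setminus\{1\}$ with $q\ne p$, there is no isometric embedding of $S_q^m$ into $L_p(\mathcal M)$; 2. if $p\notin\{\tfrac1k:k\in\mathbb N,\ k\ge 1\}$, there is no isometric embedding of $S_1^m$ into $L_p(\mathcal M)$; 3. if $p\notin\{\tfrac1k:k\in\mathbb N,\ k\ge 1\}$, there is no isometric embedding of $S_\infty^m$ into $L_p(\mathcal M)$. -/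

import Mathlib

open scoped ENNReal NNReal

/-- A normal semifinite faithful trace on a C⋆-algebra `M`, as a function `M₊ → [0, ∞]` on the
positive cone. -/
structure IsNSFTrace {M : Type*} [CStarAlgebra M] [PartialOrder M] [StarOrderedRing M]
    (τ : {x : M // 0 ≤ x} → ℝ≥0∞) : Prop where
  /-- Additivity on the positive cone. -/
  map_add : ∀ x y : {x : M // 0 ≤ x}, τ (x + y) = τ x + τ y
  /-- Positive homogeneity (with the convention `0 * ∞ = 0`). -/
  map_smul : ∀ (r : ℝ≥0) (x : {x : M // 0 ≤ x}),
    τ ⟨(r : ℝ) • (x : M), smul_nonneg r.2 x.2⟩ = r * τ x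
  /-- The trace property `τ (x⋆ x) = τ (x x⋆)`. -/
  map_star_mul_self : ∀ x : M,
    τ ⟨star x * x, star_mul_self_nonneg x⟩ = τ ⟨x * star x, mul_star_self_nonneg x⟩
  /-- Normality: `τ` preserves suprema of upward directed families of positive elements. -/
  normal : ∀ (D : Set {x : M // 0 ≤ x}) (x : {x : M // 0 ≤ x}),
    D.Nonempty → DirectedOn (· ≤ ·) D → IsLUB D x → IsLUB (τ '' D) (τ x)
  /-- Semifiniteness: every nonzero positive element dominates a nonzero positive element of
  finite trace. -/
  semifinite : ∀ x : {x : M // 0 ≤ x}, (x : M) ≠ 0 →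
    ∃ y : {x : M // 0 ≤ x}, y ≤ x ∧ (y : M) ≠ 0 ∧ τ y < ∞
  /-- Faithfulness. -/
  faithful : ∀ x : {x : M // 0 ≤ x}, τ x = 0 → (x : M) = 0

/-- The `L_p`-(quasi-)norm of an element `x` of `M` for the trace `τ`: it is
`‖x‖_p = τ (|x| ^ p) ^ (1 / p)` for `0 < p < ∞`, where `|x| = (x⋆ x) ^ (1 / 2)` and the powers are
taken by functional calculus, and it is the norm of `M` for `p = ∞` (the value at `p = 0` has no
meaning). -/
noncomputable def ncLpNorm {M : Type*} [CStarAlgebra M] [PartialOrder M] [StarOrderedRing M]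
    (τ : {x : M // 0 ≤ x} → ℝ≥0∞) (p : ℝ≥0∞) (x : M) : ℝ≥0∞ :=
  if p = ∞ then ENNReal.ofReal ‖x‖
  else τ ⟨CFC.abs x ^ p.toReal, CFC.rpow_nonneg⟩ ^ (1 / p.toReal)

/-- The usual trace `Tr` on the positive cone of `B(ℓ₂ᵐ)`. With this trace, the space `L_q` of
`B(ℓ₂ᵐ)` is the Schatten class `S_q^m`. -/
noncomputable def usualTrace (m : ℕ)
    (x : {x : EuclideanSpace ℂ (Fin m) →L[ℂ] EuclideanSpace ℂ (Fin m) // 0 ≤ x}) : ℝ≥0∞ :=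
  ENNReal.ofReal
    (LinearMap.trace ℂ (EuclideanSpace ℂ (Fin m))
      (x.1 : EuclideanSpace ℂ (Fin m) →ₗ[ℂ] EuclideanSpace ℂ (Fin m))).re

/-- `S_q^m` embeds isometrically into `L_p(M, τ)`, for a finite-dimensional `M`: there is a
`ℂ`-linear map `T` with `‖T x‖_p = ‖x‖_q` for all `x`. In finite dimension every element of `M` is
a linear combination of positive elements with support of finite trace, and `M` is complete for
the `L_p`-quasi-norm, so that the vector space underlying `L_p(M, τ)` is `M` itself. -/
def SchattenEmbedsInLp {M : Type*} [CStarAlgebra M] [PartialOrder M] [StarOrderedRing M]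
    [FiniteDimensional ℂ M] (m : ℕ) (q : ℝ≥0∞) (τ : {x : M // 0 ≤ x} → ℝ≥0∞) (p : ℝ≥0∞) : Prop :=
  ∃ T : (EuclideanSpace ℂ (Fin m) →L[ℂ] EuclideanSpace ℂ (Fin m)) →ₗ[ℂ] M,
    ∀ x, ncLpNorm τ p (T x) = ncLpNorm (usualTrace m) q x

/-! An embedding is tested on the real diagonal operators `e_i + t e_j` alone. With `A + sB` the
image of such a line, `‖A + sB‖_p^p` is the trace of `H(s)^(p/2)`, where `H(s) = (A + sB)⋆(A + sB)`
is a positive polynomial in `s`. It is a weighted sum of the powers `l^(p/2)` over the eigenvalues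
`l` of `H(s)`.

Eigenvalues staying away from `0` contribute a power series in `s`. Those tending to `0` have
nonnegative moments with expansions in `s`, so they are `O(s²)`; divided by `s²` they satisfy the
same hypotheses, and the argument repeats. Hence, to every order, `‖A + sB‖_p^p ~ ∑ |s|^(pk)
Q_k(s)`, where `Q_k(0) ≥ 0`, and `Q_k = 0` if `Q_k(0) = 0` (`IsSpectralFamily.exists_expansion`).
Adding the values at `s` and `-s` leaves the terms `c_k s^(pk) + d_k s^(pk+2)` up to `O(s⁴)`.

On the Schatten side with `q < 2` the same sum is `2(1 + s^q)^(p/q)`. Its term in `s^q` forces `q =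
pk`. If `p < q`, its term in `s^(2q)` is negative, so it comes from some `d_k` with `pk + 2 = 2q`;
for `k ≠ 0` this makes `c_k > 0` at the exponent `2q - 2 < q`, where nothing occurs. So `k = 0` and
`q = 1`. For `S_∞` the kink of `max(1, |t|)` at `t = 1` gives a term `p s`, which forces `pk = 1`.
-/

/-! ### Asymptotic expansions at a point and Hermite interpolation. -/

section Expansions

open Filter Topology Asymptotics Polynomial

/-- A real function has polynomial approximations of every order at `0` (punctured). -/
def HasExpansion (f : ℝ → ℝ) : Prop :=
  ∀ N : ℕ, ∃ P : ℝ[X], (fun s => f s - P.eval s) =O[𝓝[≠] 0] fun s => s ^ N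

/-- Taylor polynomials of an analytic function. -/
theorem AnalyticAt.exists_polynomial_isBigO {f : ℝ → ℝ} {z : ℝ} (hf : AnalyticAt ℝ f z) (N : ℕ) :
    ∃ P : ℝ[X], (fun y => f (z + y) - P.eval y) =O[𝓝 0] fun y => y ^ N := by
  obtain ⟨p, hp⟩ := hf
  refine ⟨∑ k ∈ Finset.range N, C (p.coeff k) * X ^ k, ?_⟩
  have h := hp.isBigO_sub_partialSum_pow N
  have h2 : (fun y : ℝ => ‖y‖ ^ N) =O[𝓝 0] fun y => y ^ N :=
    isBigO_of_le _ fun y => by simp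
  refine (h.trans h2).congr_left fun y => ?_
  congr 1
  simp only [FormalMultilinearSeries.partialSum, eval_finsetSum, eval_mul, eval_C, eval_pow,
    eval_X]
  refine Finset.sum_congr rfl fun k _ => ?_
  rw [FormalMultilinearSeries.apply_eq_pow_smul_coeff, smul_eq_mul, mul_comm]

theorem HasExpansion.of_analyticAt {f : ℝ → ℝ} (hf : AnalyticAt ℝ f 0) : HasExpansion f := by
  intro N
  obtain ⟨P, hP⟩ := hf.exists_polynomial_isBigO N
  exact ⟨P, (hP.mono nhdsWithin_le_nhds).congr_left fun y => by simp⟩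

theorem HasExpansion.add {f g : ℝ → ℝ} (hf : HasExpansion f) (hg : HasExpansion g) :
    HasExpansion fun s => f s + g s := by
  intro N
  obtain ⟨P, hP⟩ := hf N
  obtain ⟨Q, hQ⟩ := hg N
  exact ⟨P + Q, (hP.add hQ).congr_left fun s => by simp; ring⟩

theorem HasExpansion.const_mul {f : ℝ → ℝ} (c : ℝ) (hf : HasExpansion f) :
    HasExpansion fun s => c * f s := by
  intro N
  obtain ⟨P, hP⟩ := hf N
  exact ⟨C c * P, (hP.const_mul_left c).congr_left fun s => by simp; ring⟩

theorem HasExpansion.sum {κ : Type*} (S : Finset κ) {f : κ → ℝ → ℝ}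
    (hf : ∀ k ∈ S, HasExpansion (f k)) : HasExpansion fun s => ∑ k ∈ S, f k s := by
  classical
  induction S using Finset.induction_on with
  | empty => exact fun N => ⟨0, by simpa using isBigO_zero _ _⟩
  | insert a S ha ih =>
    simp only [Finset.sum_insert ha]
    exact (hf a (by simp)).add (ih fun k hk => hf k (by simp [hk]))

theorem Polynomial.tendsto_eval_punctured (P : ℝ[X]) :
    Tendsto (fun s => P.eval s) (𝓝[≠] 0) (𝓝 (P.eval 0)) :=
  (P.continuous.tendsto 0).mono_left nhdsWithin_le_nhds

theorem Polynomial.X_pow_dvd_of_isBigO {P : ℝ[X]} {n : ℕ}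
    (h : (fun s => P.eval s) =O[𝓝[≠] 0] fun s : ℝ => s ^ n) : X ^ n ∣ P := by
  by_cases hP : P = 0
  · simp [hP]
  obtain ⟨Q, hQ, hQ0⟩ := exists_eq_pow_rootMultiplicity_mul_and_not_dvd P hP 0
  set k := rootMultiplicity 0 P
  simp only [C_0, sub_zero] at hQ hQ0
  by_cases hk : n ≤ k
  · rw [hQ]
    exact (pow_dvd_pow X hk).mul_right Q
  exfalso
  push Not at hk
  apply hQ0
  rw [X_dvd_iff, coeff_zero_eq_eval_zero]
  have h1 : (fun s => Q.eval s) =O[𝓝[≠] 0] fun s : ℝ => s ^ (n - k) := by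
    have h2 := h.mul (isBigO_refl (fun s : ℝ => (s ^ k)⁻¹) (𝓝[≠] 0))
    refine h2.congr' ?_ ?_
    · filter_upwards [self_mem_nhdsWithin] with s (hs : s ≠ 0)
      rw [hQ]
      simp only [eval_mul, eval_pow, eval_X]
      field_simp
    · filter_upwards [self_mem_nhdsWithin] with s (hs : s ≠ 0)
      rw [pow_sub₀ _ hs hk.le]
  have h3 : Tendsto (fun s : ℝ => s ^ (n - k)) (𝓝[≠] 0) (𝓝 0) := by
    have : Tendsto (fun s : ℝ => s ^ (n - k)) (𝓝 0) (𝓝 (0 ^ (n - k))) :=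
      (continuous_pow (n - k)).tendsto 0
    rw [zero_pow (by omega)] at this
    exact this.mono_left nhdsWithin_le_nhds
  exact tendsto_nhds_unique Q.tendsto_eval_punctured (h1.trans_tendsto h3)

theorem isBigO_pow_pow_punctured {m n : ℕ} (h : n ≤ m) :
    (fun s : ℝ => s ^ m) =O[𝓝[≠] 0] fun s => s ^ n := by
  rcases h.eq_or_lt with rfl | h
  · exact isBigO_refl _ _
  · exact (isLittleO_pow_pow h).isBigO.mono nhdsWithin_le_nhds

theorem Polynomial.isBigO_of_X_pow_dvd {P : ℝ[X]} {n : ℕ} (h : X ^ n ∣ P) :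
    (fun s => P.eval s) =O[𝓝[≠] 0] fun s : ℝ => s ^ n := by
  obtain ⟨Q, rfl⟩ := h
  have := (isBigO_refl (fun s : ℝ => s ^ n) (𝓝[≠] 0)).mul (Q.tendsto_eval_punctured.isBigO_one ℝ)
  simpa using this

theorem HasExpansion.div_pow {f : ℝ → ℝ} {n : ℕ} (hf : HasExpansion f)
    (h : f =O[𝓝[≠] 0] fun s => s ^ n) : HasExpansion fun s => f s / s ^ n := by
  intro N
  obtain ⟨P, hP⟩ := hf (N + n)
  have h1 : (fun s => P.eval s) =O[𝓝[≠] 0] fun s : ℝ => s ^ n :=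
    (h.sub (hP.trans (isBigO_pow_pow_punctured (Nat.le_add_left n N)))).congr_left
      fun s => by ring
  obtain ⟨Q, rfl⟩ := X_pow_dvd_of_isBigO h1
  refine ⟨Q, ?_⟩
  have h2 := hP.mul (isBigO_refl (fun s : ℝ => (s ^ n)⁻¹) (𝓝[≠] 0))
  refine h2.congr' ?_ ?_
  · filter_upwards [self_mem_nhdsWithin] with s (hs : s ≠ 0)
    simp only [eval_mul, eval_pow, eval_X]
    field_simp
  · filter_upwards [self_mem_nhdsWithin] with s (hs : s ≠ 0)
    rw [pow_add]
    field_simp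

/-- A nonnegative function with expansions whose constant term vanishes is `O(s²)`. -/
theorem HasExpansion.isBigO_sq_of_nonneg {f : ℝ → ℝ} {U : Filter ℝ} [U.NeBot] (hU : U ≤ 𝓝[≠] 0)
    (hf : HasExpansion f) (h0 : ∀ᶠ s in 𝓝[≠] 0, 0 ≤ f s) (hlim : Tendsto f U (𝓝 0)) :
    f =O[𝓝[≠] 0] fun s => s ^ 2 := by
  obtain ⟨P, hP⟩ := hf 2
  -- The polynomial converges along the whole punctured neighbourhood, so a limit along the finer
  -- filter `U` already determines its constant term.
  have hP0 : P.eval 0 = 0 := by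
    have h1 : Tendsto (fun s : ℝ => s ^ 2) (𝓝[≠] 0) (𝓝 0) := by
      have : Tendsto (fun s : ℝ => s ^ 2) (𝓝 0) (𝓝 (0 ^ 2)) := (continuous_pow 2).tendsto 0
      rw [zero_pow two_ne_zero] at this
      exact this.mono_left nhdsWithin_le_nhds
    have h2 := hlim.sub ((hP.trans_tendsto h1).mono_left hU)
    exact tendsto_nhds_unique (P.tendsto_eval_punctured.mono_left hU) (by simpa using h2)
  obtain ⟨Q, rfl⟩ : X ∣ P := by rwa [X_dvd_iff, coeff_zero_eq_eval_zero]
  have hlimQ : Tendsto (fun s => f s / s) (𝓝[≠] 0) (𝓝 (Q.eval 0)) := by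
    have h1 : (fun s : ℝ => (f s - (X * Q).eval s) * s⁻¹) =O[𝓝[≠] 0] fun s => s := by
      refine (hP.mul (isBigO_refl (fun s : ℝ => s⁻¹) (𝓝[≠] 0))).congr' EventuallyEq.rfl ?_
      filter_upwards [self_mem_nhdsWithin] with s (hs : s ≠ 0)
      field_simp
    have h2 := (h1.trans_tendsto (tendsto_id.mono_left nhdsWithin_le_nhds)).add
      Q.tendsto_eval_punctured
    rw [zero_add] at h2
    refine h2.congr' ?_
    filter_upwards [self_mem_nhdsWithin] with s (hs : s ≠ 0)
    simp only [eval_mul, eval_X]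
    field_simp
    ring
  -- `f s / s` tends to the linear coefficient; it is nonnegative on the right and nonpositive on
  -- the left of `0`, so this coefficient vanishes.
  have hpos : 0 ≤ Q.eval 0 := by
    have hle : 𝓝[>] (0 : ℝ) ≤ 𝓝[≠] 0 := nhdsWithin_mono _ fun s hs => ne_of_gt hs
    refine ge_of_tendsto (hlimQ.mono_left hle) ?_
    filter_upwards [h0.filter_mono hle, self_mem_nhdsWithin] with s hs (hs' : 0 < s)
    positivity
  have hneg : Q.eval 0 ≤ 0 := by
    have hle : 𝓝[<] (0 : ℝ) ≤ 𝓝[≠] 0 := nhdsWithin_mono _ fun s hs => ne_of_lt hs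
    refine le_of_tendsto (hlimQ.mono_left hle) ?_
    filter_upwards [h0.filter_mono hle, self_mem_nhdsWithin] with s hs (hs' : s < 0)
    exact div_nonpos_of_nonneg_of_nonpos hs hs'.le
  obtain ⟨R, rfl⟩ : X ∣ Q := by
    rw [X_dvd_iff, coeff_zero_eq_eval_zero]; exact le_antisymm hneg hpos
  have h3 : (fun s => (X * (X * R)).eval s) =O[𝓝[≠] 0] fun s : ℝ => s ^ 2 :=
    isBigO_of_X_pow_dvd ⟨R, by ring⟩
  exact (hP.add h3).congr_left fun s => by ring

/-- The distance to a finite set is controlled by the product of the distances to its points. -/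
theorem Finset.exists_abs_sub_le_mul_prod (Z : Finset ℝ) (hZ : Z.Nonempty) :
    ∃ A : ℝ, 0 < A ∧ ∀ x : ℝ, ∃ z ∈ Z, |x - z| ≤ A * ∏ y ∈ Z, |x - y| := by
  classical
  induction hZ using Finset.Nonempty.cons_induction with
  | singleton a => exact ⟨1, one_pos, fun x => ⟨a, by simp, by simp⟩⟩
  | cons a Z ha hZ ih =>
    obtain ⟨A, hA, h⟩ := ih
    obtain ⟨η, hη, hηZ⟩ : ∃ η : ℝ, 0 < η ∧ ∀ z ∈ Z, 2 * η ≤ |a - z| := by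
      obtain ⟨z, hz, hmin⟩ := Z.exists_min_image (fun z => |a - z|) hZ
      have hne : a - z ≠ 0 := sub_ne_zero.2 fun h => ha (h ▸ hz)
      exact ⟨|a - z| / 2, by positivity, fun y hy => by linarith [hmin y hy]⟩
    -- First summand: `x` is at distance at least `η` from `a`, and induction applies. Second: `x`
    -- is near `a`, hence at distance at least `η` from each point of `Z`.
    refine ⟨A / η + (η ^ Z.card)⁻¹, by positivity, fun x => ?_⟩
    simp only [Finset.prod_cons, Finset.mem_cons]
    have hprod : 0 ≤ ∏ y ∈ Z, |x - y| := Finset.prod_nonneg fun _ _ => abs_nonneg _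
    rcases le_or_gt η |x - a| with hx | hx
    · obtain ⟨z, hz, hzx⟩ := h x
      refine ⟨z, Or.inr hz, hzx.trans ?_⟩
      have h1 : A * ∏ y ∈ Z, |x - y| ≤ A / η * (|x - a| * ∏ y ∈ Z, |x - y|) := by
        rw [div_mul_eq_mul_div, le_div_iff₀ hη]
        nlinarith [mul_le_mul_of_nonneg_left hx (mul_nonneg hA.le hprod)]
      have h2 : 0 ≤ (η ^ Z.card)⁻¹ * (|x - a| * ∏ y ∈ Z, |x - y|) := by positivity
      linarith
    · refine ⟨a, Or.inl rfl, ?_⟩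
      have h1 : η ^ Z.card ≤ ∏ y ∈ Z, |x - y| := by
        rw [← Finset.prod_const]
        refine Finset.prod_le_prod (fun _ _ => hη.le) fun y hy => ?_
        have h2 := hηZ y hy
        have h3 := abs_sub_le a x y
        rw [abs_sub_comm a x] at h3
        linarith
      have h2 : |x - a| ≤ (η ^ Z.card)⁻¹ * (|x - a| * ∏ y ∈ Z, |x - y|) := by
        rw [inv_mul_eq_div, le_div_iff₀ (by positivity)]
        exact mul_le_mul_of_nonneg_left h1 (abs_nonneg _)
      have h3 : 0 ≤ A / η * (|x - a| * ∏ y ∈ Z, |x - y|) := by positivity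
      linarith

/-- Hermite interpolation, in the form of a local error estimate. -/
theorem exists_hermite_interpolation (Z : Finset ℝ) (F : ℝ → ℝ) (hF : ∀ z ∈ Z, AnalyticAt ℝ F z)
    (N : ℕ) : ∃ h : ℝ[X], ∀ z ∈ Z, (fun x => F x - h.eval x) =O[𝓝 z] fun x => (x - z) ^ N := by
  have hT : ∀ z : Z, ∃ T : ℝ[X],
      (fun x => F x - T.eval x) =O[𝓝 (z : ℝ)] fun x => (x - z) ^ N := by
    intro z
    obtain ⟨P, hP⟩ := (hF z z.2).exists_polynomial_isBigO N
    refine ⟨P.comp (X - C (z : ℝ)), ?_⟩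
    have ht : Tendsto (fun x : ℝ => x - z) (𝓝 z) (𝓝 0) := by
      have : Tendsto (fun x : ℝ => x - z) (𝓝 z) (𝓝 ((z : ℝ) - z)) :=
        (continuous_id.sub continuous_const).tendsto _
      rwa [sub_self] at this
    refine (hP.comp_tendsto ht).congr_left fun x => ?_
    simp
  choose T hT using hT
  have hcop : Pairwise (Function.onFun IsCoprime
      fun z : Z => Ideal.span {(X - C (z : ℝ)) ^ N}) := by
    intro y z hyz
    simp only [Function.onFun, Ideal.isCoprime_span_singleton_iff]
    exact (pairwise_coprime_X_sub_C (s := fun z : Z => (z : ℝ)) Subtype.val_injective hyz).pow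
  obtain ⟨h, hh⟩ := Ideal.exists_forall_sub_mem_ideal hcop T
  refine ⟨h, fun z hz => ?_⟩
  obtain ⟨k, hk⟩ := Ideal.mem_span_singleton'.1 (hh ⟨z, hz⟩)
  have h1 : (fun x => k.eval x * (x - z) ^ N) =O[𝓝 z] fun x => (x - z) ^ N := by
    have := ((k.continuous.tendsto z).isBigO_one ℝ).mul
      (isBigO_refl (fun x : ℝ => (x - z) ^ N) (𝓝 z))
    simpa using this
  refine ((hT ⟨z, hz⟩).sub h1).congr_left fun x => ?_
  have := congrArg (Polynomial.eval x) hk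
  simp only [eval_mul, eval_pow, eval_sub, eval_X, eval_C] at this
  simp only [this]
  ring

end Expansions

/-! ### Weighted eigenvalue families and their generalized power series. -/

section SpectralFamilies

open Filter Topology Asymptotics Polynomial

variable {ι : Type*} [Fintype ι]

/-- Finitely many points `l s i ≥ 0` with weights `w s i` bounded above and below, whose moments of
positive order have expansions at `s = 0`. -/
structure IsSpectralFamily (w l : ℝ → ι → ℝ) : Prop where
  nonneg : ∀ s i, 0 ≤ l s i
  weight_pos : ∃ w₀ : ℝ, 0 < w₀ ∧ ∀ s i, w₀ ≤ w s i
  weight_le : ∃ W : ℝ, ∀ s i, w s i ≤ W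
  moment : ∀ r : ℕ, 1 ≤ r → HasExpansion fun s => ∑ i, w s i * l s i ^ r

/-- Limits of the points and weights of a spectral family along an ultrafilter. -/
structure IsLimitData (w l : ℝ → ι → ℝ) (U : Ultrafilter ℝ) (wl ll : ι → ℝ) : Prop where
  le : (U : Filter ℝ) ≤ 𝓝[≠] 0
  weight_pos : ∀ i, 0 < wl i
  nonneg : ∀ i, 0 ≤ ll i
  tendsto_weight : ∀ i, Tendsto (fun s => w s i) U (𝓝 (wl i))
  tendsto : ∀ i, Tendsto (fun s => l s i) U (𝓝 (ll i))

/-- Points and weights are chosen for each `s` separately, without any continuity. The first moment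
bounds the points, and an ultrafilter makes all of them converge at once. -/
theorem IsSpectralFamily.exists_isLimitData {w l : ℝ → ι → ℝ} (h : IsSpectralFamily w l) :
    ∃ U wl ll, IsLimitData w l U wl ll := by
  obtain ⟨w₀, hw₀, hw⟩ := h.weight_pos
  obtain ⟨W, hW⟩ := h.weight_le
  let U : Ultrafilter ℝ := Ultrafilter.of (𝓝[≠] 0)
  have hU : (U : Filter ℝ) ≤ 𝓝[≠] 0 := Ultrafilter.of_le _
  have key : ∀ (f : ℝ → ℝ) (a b : ℝ), (∀ᶠ s in 𝓝[≠] 0, f s ∈ Set.Icc a b) →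
      ∃ x ∈ Set.Icc a b, Tendsto f U (𝓝 x) := by
    intro f a b hf
    exact (isCompact_Icc (a := a) (b := b)).ultrafilter_le_nhds (U.map f)
      (le_principal_iff.2 (hU hf))
  obtain ⟨P, hP⟩ := h.moment 1 le_rfl 0
  have hbd : (fun s => ∑ i, w s i * l s i ^ 1) =O[𝓝[≠] 0] fun _ => (1 : ℝ) :=
    ((hP.trans (by simpa using isBigO_refl (fun _ => (1 : ℝ)) _)).add
      (P.tendsto_eval_punctured.isBigO_one ℝ)).congr_left fun s => by ring
  obtain ⟨R, hR⟩ := hbd.bound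
  have hl : ∀ i, ∀ᶠ s in 𝓝[≠] 0, l s i ∈ Set.Icc 0 (R / w₀) := by
    intro i
    filter_upwards [hR] with s hs
    refine ⟨h.nonneg s i, ?_⟩
    rw [le_div_iff₀ hw₀]
    have h1 : w s i * l s i ^ 1 ≤ ∑ i, w s i * l s i ^ 1 :=
      Finset.single_le_sum (f := fun i => w s i * l s i ^ 1)
        (fun j _ => mul_nonneg (hw₀.le.trans (hw s j)) (pow_nonneg (h.nonneg s j) 1))
        (Finset.mem_univ i)
    have h2 := (le_abs_self _).trans hs
    rw [norm_one, mul_one] at h2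
    have h3 := mul_le_mul_of_nonneg_right (hw s i) (h.nonneg s i)
    rw [pow_one] at h1
    linarith
  choose ll hll hllt using fun i => key _ _ _ (hl i)
  choose wl hwl hwlt using fun i => key (fun s => w s i) w₀ W
    (Eventually.of_forall fun s => ⟨hw s i, hW s i⟩)
  exact ⟨U, wl, ll, hU, fun i => hw₀.trans_le (hwl i).1, fun i => (hll i).1, hwlt, hllt⟩

theorem IsSpectralFamily.isBigO_weight {w l : ℝ → ι → ℝ} (h : IsSpectralFamily w l) (i : ι)
    (L : Filter ℝ) : (fun s => w s i) =O[L] fun _ => (1 : ℝ) := by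
  obtain ⟨w₀, hw₀, hw⟩ := h.weight_pos
  obtain ⟨W, hW⟩ := h.weight_le
  refine IsBigO.of_bound W (Eventually.of_forall fun s => ?_)
  rw [norm_one, mul_one, Real.norm_eq_abs, abs_of_nonneg (hw₀.le.trans (hw s i))]
  exact hW s i

theorem IsSpectralFamily.hasExpansion_polynomial {w l : ℝ → ι → ℝ} (h : IsSpectralFamily w l)
    (g : ℝ[X]) (hg : g.eval 0 = 0) : HasExpansion fun s => ∑ i, w s i * g.eval (l s i) := by
  have h1 : HasExpansion fun s => ∑ r ∈ Finset.range (g.natDegree + 1),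
      g.coeff r * ∑ i, w s i * l s i ^ r := by
    refine HasExpansion.sum _ fun r _ => ?_
    rcases Nat.eq_zero_or_pos r with rfl | hr
    · rw [coeff_zero_eq_eval_zero, hg]
      exact fun N => ⟨0, by simpa using isBigO_zero _ _⟩
    · exact (h.moment r hr).const_mul _
  convert h1 using 2 with s
  simp only [eval_eq_sum_range, Finset.mul_sum]
  rw [Finset.sum_comm]
  exact Finset.sum_congr rfl fun _ _ => Finset.sum_congr rfl fun _ _ => by ring

/-- If all terms of a weighted sum are nonnegative, bounds for the sum are bounds for the terms. -/
theorem IsSpectralFamily.isBigO_of_sum {w l : ℝ → ι → ℝ} (h : IsSpectralFamily w l)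
    {f : ℝ → ι → ℝ} (hf : ∀ s i, 0 ≤ f s i) {g : ℝ → ℝ}
    (hg : (fun s => ∑ i, w s i * f s i) =O[𝓝[≠] 0] g) (i : ι) :
    (fun s => f s i) =O[𝓝[≠] 0] g := by
  obtain ⟨w₀, hw₀, hw⟩ := h.weight_pos
  refine IsBigO.trans (IsBigO.of_bound w₀⁻¹ (Eventually.of_forall fun s => ?_)) hg
  have hterm : ∀ j, 0 ≤ w s j * f s j := fun j => mul_nonneg (hw₀.le.trans (hw s j)) (hf s j)
  rw [Real.norm_eq_abs, Real.norm_eq_abs, abs_of_nonneg (hf s i),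
    abs_of_nonneg (Finset.sum_nonneg fun j _ => hterm j), inv_mul_eq_div, le_div_iff₀ hw₀]
  have h1 := Finset.single_le_sum (f := fun i => w s i * f s i) (fun j _ => hterm j)
    (Finset.mem_univ i)
  have h3 := mul_le_mul_of_nonneg_right (hw s i) (hf s i)
  linarith

variable {w l : ℝ → ι → ℝ} {U : Ultrafilter ℝ} {wl ll : ι → ℝ}

theorem IsLimitData.tendsto_sum (hd : IsLimitData w l U wl ll) {F : ℝ → ℝ}
    (hF : ∀ i, ContinuousAt F (ll i)) :
    Tendsto (fun s => ∑ i, w s i * F (l s i)) U (𝓝 (∑ i, wl i * F (ll i))) :=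
  tendsto_finsetSum _ fun i _ => (hd.tendsto_weight i).mul ((hF i).tendsto.comp (hd.tendsto i))

/-- Passes from the ultrafilter to the full punctured neighbourhood. The moment of `∏ (x - z)²` is
nonnegative, has expansions and tends to `0` along `U`, so it is `O(s²)`; taking roots, each point
is within `O(s)` of `Z`. -/
theorem IsSpectralFamily.exists_near (h : IsSpectralFamily w l) (hd : IsLimitData w l U wl ll)
    {Z : Finset ℝ} (hZ0 : 0 ∈ Z) (hZ : ∀ i, ll i ∈ Z) (i : ι) :
    ∃ C : ℝ, ∀ᶠ s in 𝓝[≠] 0, ∃ z ∈ Z, |l s i - z| ≤ C * |s| := by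
  set g : ℝ[X] := ∏ z ∈ Z, (X - C z) ^ 2 with hg
  have hgz : ∀ z ∈ Z, g.eval z = 0 := by
    intro z hz
    rw [hg, eval_prod]
    exact Finset.prod_eq_zero hz (by simp)
  have hgx : ∀ x, g.eval x = (∏ z ∈ Z, |x - z|) ^ 2 := by
    intro x
    rw [hg, eval_prod, ← Finset.prod_pow]
    exact Finset.prod_congr rfl fun z _ => by simp
  have hpos : ∀ x, 0 ≤ g.eval x := fun x => by rw [hgx]; positivity
  obtain ⟨w₀, hw₀, hw⟩ := h.weight_pos
  have hlim := hd.tendsto_sum (F := fun x => g.eval x) fun i => g.continuous.continuousAt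
  simp only [hgz _ (hZ _), mul_zero, Finset.sum_const_zero] at hlim
  have hO := (h.hasExpansion_polynomial g (hgz 0 hZ0)).isBigO_sq_of_nonneg hd.le
    (Eventually.of_forall fun s => Finset.sum_nonneg fun j _ =>
      mul_nonneg (hw₀.le.trans (hw s j)) (hpos _)) hlim
  have hi := h.isBigO_of_sum (f := fun s i => g.eval (l s i)) (fun s i => hpos _) hO i
  simp only [hgx] at hi
  have hi2 : (fun s => ∏ z ∈ Z, |l s i - z|) =O[𝓝[≠] 0] fun s => s :=
    IsBigO.of_pow two_ne_zero hi
  obtain ⟨c, hc⟩ := hi2.bound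
  obtain ⟨A, hA, hAx⟩ := Z.exists_abs_sub_le_mul_prod ⟨0, hZ0⟩
  refine ⟨A * c, ?_⟩
  filter_upwards [hc] with s hs
  obtain ⟨z, hz, hzs⟩ := hAx (l s i)
  refine ⟨z, hz, hzs.trans ?_⟩
  rw [mul_assoc]
  exact mul_le_mul_of_nonneg_left ((le_abs_self _).trans hs) hA.le

/-- Functional calculus by functions analytic at the limit points preserves expansions. -/
theorem IsSpectralFamily.hasExpansion_analytic (h : IsSpectralFamily w l)
    (hd : IsLimitData w l U wl ll) {Z : Finset ℝ} (hZ0 : 0 ∈ Z) (hZ : ∀ i, ll i ∈ Z) {F : ℝ → ℝ}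
    (hF : ∀ z ∈ Z, AnalyticAt ℝ F z) (hF0 : F 0 = 0) :
    HasExpansion fun s => ∑ i, w s i * F (l s i) := by
  intro N
  -- A positive order makes the error vanish at the nodes themselves, which gives `g 0 = F 0 = 0`.
  obtain ⟨g, hg⟩ := exists_hermite_interpolation Z F hF (N + 1)
  have hg0 : g.eval 0 = 0 := by
    obtain ⟨c, hc⟩ := (hg 0 hZ0).bound
    have := hc.self_of_nhds
    simpa [hF0] using this
  have herr : ∀ i, (fun s => F (l s i) - g.eval (l s i)) =O[𝓝[≠] 0] fun s => s ^ (N + 1) := by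
    intro i
    obtain ⟨C, hC⟩ := h.exists_near hd hZ0 hZ i
    -- The point of `Z` near `l s i` may change with `s`, so the bound is uniform in `x` and is
    -- later summed over all `z`.
    have hz : ∀ z ∈ Z, ∃ K : ℝ, ∀ᶠ s in 𝓝[≠] (0 : ℝ), ∀ x : ℝ, |x - z| ≤ C * |s| →
        |F x - g.eval x| ≤ K * |s| ^ (N + 1) := by
      intro z hz
      obtain ⟨c, hc0, hc⟩ := (hg z hz).exists_nonneg
      obtain ⟨ε, hε, hεc⟩ := Metric.eventually_nhds_iff.1 hc.bound
      refine ⟨c * C ^ (N + 1), ?_⟩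
      have ht : Tendsto (fun s : ℝ => C * |s|) (𝓝 0) (𝓝 (C * |0|)) :=
        (continuous_const.mul continuous_abs).tendsto 0
      rw [abs_zero, mul_zero] at ht
      filter_upwards [(ht.eventually (gt_mem_nhds hε)).filter_mono nhdsWithin_le_nhds]
        with s hs x hx
      have h1 := hεc (y := x) (by rw [Real.dist_eq]; exact hx.trans_lt hs)
      rw [Real.norm_eq_abs, norm_pow, Real.norm_eq_abs] at h1
      refine h1.trans ?_
      rw [mul_assoc, ← mul_pow]
      gcongr
    choose! K hK using hz
    refine IsBigO.of_bound (∑ z ∈ Z, |K z|) ?_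
    filter_upwards [hC, (Finset.eventually_all Z).2 hK] with s ⟨z, hzZ, hzs⟩ hs
    rw [Real.norm_eq_abs, norm_pow, Real.norm_eq_abs]
    refine (hs z hzZ _ hzs).trans (mul_le_mul_of_nonneg_right ?_ (by positivity))
    exact (le_abs_self _).trans
      (Finset.single_le_sum (f := fun z => |K z|) (fun _ _ => abs_nonneg _) hzZ)
  obtain ⟨P, hP⟩ := h.hasExpansion_polynomial g hg0 N
  refine ⟨P, ?_⟩
  have h2 : (fun s => ∑ i, w s i * (F (l s i) - g.eval (l s i))) =O[𝓝[≠] 0]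
      fun s => s ^ N := by
    refine IsBigO.fun_sum fun i _ => ?_
    have := (h.isBigO_weight i (𝓝[≠] 0)).mul (herr i)
    simp only [one_mul] at this
    exact this.trans (isBigO_pow_pow_punctured (Nat.le_succ N))
  refine (h2.add hP).congr_left fun s => ?_
  simp only [mul_sub, Finset.sum_sub_distrib]
  ring

/-- Splitting off the points that do not tend to zero; the others are `O(s²)` and, divided by `s²`,
form a spectral family again. -/
theorem IsSpectralFamily.exists_split (h : IsSpectralFamily w l) {a : ℝ} (ha : 0 < a) (N : ℕ) :
    ∃ (l' : ℝ → ι → ℝ) (Q : ℝ[X]), IsSpectralFamily w l' ∧ 0 ≤ Q.eval 0 ∧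
      (Q.eval 0 = 0 → Q = 0) ∧
      (fun s => ∑ i, w s i * l s i ^ a -
        (Q.eval s + |s| ^ (2 * a) * ∑ i, w s i * l' s i ^ a)) =O[𝓝[≠] 0] fun s => s ^ N := by
  classical
  obtain ⟨U, wl, ll, hd⟩ := h.exists_isLimitData
  obtain ⟨w₀, hw₀, hw⟩ := h.weight_pos
  set Z : Finset ℝ := insert 0 (Finset.univ.image ll) with hZdef
  have hZ0 : 0 ∈ Z := Finset.mem_insert_self _ _
  have hZ : ∀ i, ll i ∈ Z := fun i =>
    Finset.mem_insert_of_mem (Finset.mem_image_of_mem _ (Finset.mem_univ i))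
  have hZnn : ∀ z ∈ Z, 0 ≤ z := by
    intro z hz
    rcases Finset.mem_insert.1 hz with rfl | hz
    · exact le_rfl
    · obtain ⟨i, -, rfl⟩ := Finset.mem_image.1 hz
      exact hd.nonneg i
  -- `δ` separates `0` from the other limit points, so a function defined piecewise on the two sides
  -- of `δ` is analytic at all points of `Z` when its pieces are analytic where needed.
  obtain ⟨δ, hδ, hδZ⟩ : ∃ δ : ℝ, 0 < δ ∧ ∀ z ∈ Z, z ≠ 0 → δ < z := by
    rcases (Z.erase 0).eq_empty_or_nonempty with he | hne
    · refine ⟨1, one_pos, fun z hz hz0 => ?_⟩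
      exact absurd (Finset.mem_erase.2 ⟨hz0, hz⟩) (by simp [he])
    · obtain ⟨z, hz, hmin⟩ := (Z.erase 0).exists_min_image id hne
      have hz' := Finset.mem_erase.1 hz
      have hzpos : 0 < z := lt_of_le_of_ne (hZnn z hz'.2) (Ne.symm hz'.1)
      refine ⟨z / 2, by positivity, fun y hy hy0 => ?_⟩
      have := hmin y (Finset.mem_erase.2 ⟨hy0, hy⟩)
      simp only [id] at this
      linarith
  have hsmall : ∀ f g : ℝ → ℝ, (fun x => if x < δ then f x else g x) =ᶠ[𝓝 0] f := fun f g => by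
    filter_upwards [gt_mem_nhds hδ] with x hx
    simp [hx]
  have hlarge : ∀ f g : ℝ → ℝ, ∀ z ∈ Z, z ≠ 0 →
      (fun x => if x < δ then f x else g x) =ᶠ[𝓝 z] g := fun f g z hz hz0 => by
    filter_upwards [lt_mem_nhds (hδZ z hz hz0)] with x hx
    simp [hx.le]
  have hanal : ∀ f g : ℝ → ℝ, AnalyticAt ℝ f 0 → (∀ z, 0 < z → AnalyticAt ℝ g z) →
      ∀ z ∈ Z, AnalyticAt ℝ (fun x => if x < δ then f x else g x) z := by
    intro f g hf hg z hz
    rcases eq_or_ne z 0 with rfl | hz0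
    · exact hf.congr (hsmall f g).symm
    · exact (hg z (lt_of_le_of_ne (hZnn z hz) (Ne.symm hz0))).congr (hlarge f g z hz hz0).symm
  -- The points below `δ`.
  set t : ℝ → ι → ℝ := fun s i => if l s i < δ then l s i else 0 with ht
  have htnn : ∀ s i, 0 ≤ t s i := fun s i => by
    simp only [ht]; split_ifs
    exacts [h.nonneg s i, le_rfl]
  have htmom : ∀ r : ℕ, 1 ≤ r → HasExpansion fun s => ∑ i, w s i * t s i ^ r := by
    intro r hr
    have hr0 : r ≠ 0 := by omega
    have := h.hasExpansion_analytic hd hZ0 hZ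
      (hanal (fun x => x ^ r) (fun _ => 0) (by fun_prop) fun z _ => by fun_prop)
      (by simp [hδ, hr0])
    convert this using 5 with s i
    simp only [ht]
    split_ifs <;> simp [hr0]
  have ht2 : ∀ i, (fun s => t s i) =O[𝓝[≠] 0] fun s => s ^ 2 := by
    refine h.isBigO_of_sum htnn ?_
    have h1 := htmom 1 le_rfl
    simp only [pow_one] at h1
    refine h1.isBigO_sq_of_nonneg hd.le (Eventually.of_forall fun s =>
      Finset.sum_nonneg fun i _ => mul_nonneg (hw₀.le.trans (hw s i)) (htnn s i)) ?_
    have h2 := hd.tendsto_sum (F := fun x => if x < δ then x else 0) fun i =>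
      (hanal (fun x => x) (fun _ => 0) (by fun_prop) (fun z _ => by fun_prop) _ (hZ i)).continuousAt
    have h3 : ∀ i, (if ll i < δ then ll i else 0) = 0 := by
      intro i
      rcases eq_or_ne (ll i) 0 with h0 | h0
      · simp [h0]
      · rw [if_neg (hδZ _ (hZ i) h0).le.not_gt]
    simpa only [h3, mul_zero, Finset.sum_const_zero] using h2
  set l' : ℝ → ι → ℝ := fun s i => t s i / s ^ 2 with hl'
  have hfam : IsSpectralFamily w l' := by
    refine ⟨fun s i => div_nonneg (htnn s i) (sq_nonneg s), ⟨w₀, hw₀, hw⟩, h.weight_le, ?_⟩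
    intro r hr
    have h1 : (fun s => ∑ i, w s i * t s i ^ r) =O[𝓝[≠] 0] fun s => s ^ (2 * r) := by
      refine IsBigO.fun_sum fun i _ => ?_
      have := (h.isBigO_weight i (𝓝[≠] 0)).mul ((ht2 i).pow r)
      simpa only [one_mul, ← pow_mul] using this
    convert (htmom r hr).div_pow h1 using 2 with s
    rw [Finset.sum_div]
    refine Finset.sum_congr rfl fun i _ => ?_
    rw [hl', div_pow, ← pow_mul, mul_div_assoc]
  -- The points above `δ`.
  have hFa : ∀ z ∈ Z, AnalyticAt ℝ (fun x : ℝ => if x < δ then 0 else x ^ a) z :=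
    hanal (fun _ => 0) (fun x => x ^ a) (by fun_prop) fun z hz =>
      (Real.contDiffAt_rpow_const_of_ne hz.ne').analyticAt
  have hexp := h.hasExpansion_analytic hd hZ0 hZ hFa (by simp [hδ])
  have hsplit : ∀ s, s ≠ 0 → ∑ i, w s i * l s i ^ a =
      ∑ i, w s i * (if l s i < δ then 0 else l s i ^ a) +
        |s| ^ (2 * a) * ∑ i, w s i * l' s i ^ a := by
    intro s hs
    rw [Finset.mul_sum, ← Finset.sum_add_distrib]
    refine Finset.sum_congr rfl fun i _ => ?_
    have h1 : |s| ^ (2 * a) * l' s i ^ a = t s i ^ a := by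
      have h2 : |s| ^ (2 * a) = (s ^ 2) ^ a := by
        rw [← sq_abs, Real.rpow_mul (abs_nonneg s), Real.rpow_two]
      rw [h2, ← Real.mul_rpow (sq_nonneg s) (hfam.nonneg s i)]
      congr 1
      simp only [hl']
      field_simp
    rw [mul_left_comm, h1, ← mul_add]
    congr 1
    simp only [ht]
    split_ifs <;> simp [Real.zero_rpow ha.ne']
  have hlim := hd.tendsto_sum fun i => (hFa _ (hZ i)).continuousAt
  have hterm : ∀ i, 0 ≤ wl i * (if ll i < δ then 0 else ll i ^ a) := by
    intro i
    refine mul_nonneg (hd.weight_pos i).le ?_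
    split_ifs
    exacts [le_rfl, Real.rpow_nonneg (hd.nonneg i) a]
  -- If all limits are `0`, every point is eventually below `δ` and the upper part is exactly `0`,
  -- so `Q = 0` works. Otherwise `Q 0` is a sum of nonnegative terms, one of them positive.
  by_cases hzero : ∀ i, ll i = 0
  · refine ⟨l', 0, hfam, by simp, fun _ => rfl, ?_⟩
    have hev : ∀ i, ∀ᶠ s in 𝓝[≠] 0, l s i < δ := by
      intro i
      obtain ⟨C, hC⟩ := h.exists_near hd hZ0 hZ i
      have hlim0 : Tendsto (fun s : ℝ => C * |s|) (𝓝 0) (𝓝 (C * |0|)) :=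
        (continuous_const.mul continuous_abs).tendsto 0
      rw [abs_zero, mul_zero] at hlim0
      filter_upwards [hC, (hlim0.eventually (gt_mem_nhds hδ)).filter_mono nhdsWithin_le_nhds]
        with s ⟨z, hz, hzs⟩ hs
      have hz0 : z = 0 := by
        rcases Finset.mem_insert.1 hz with rfl | hz
        · rfl
        · obtain ⟨i, -, rfl⟩ := Finset.mem_image.1 hz
          exact hzero i
      rw [hz0, sub_zero] at hzs
      exact (le_abs_self _).trans_lt (hzs.trans_lt hs)
    refine (isBigO_zero (fun s : ℝ => s ^ N) (𝓝[≠] 0)).congr' ?_ EventuallyEq.rfl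
    filter_upwards [eventually_all.2 hev, self_mem_nhdsWithin] with s hs hs0
    rw [hsplit s hs0]
    simp [hs]
  · push Not at hzero
    obtain ⟨i, hi⟩ := hzero
    -- The order is raised so that the error tends to `0` even for `N = 0`, which identifies `Q 0`
    -- with the limit along `U`.
    obtain ⟨Q, hQ⟩ := hexp (N + 1)
    have hQ0 : Q.eval 0 = ∑ i, wl i * (if ll i < δ then 0 else ll i ^ a) := by
      have h1 : Tendsto (fun s : ℝ => s ^ (N + 1)) (𝓝[≠] 0) (𝓝 0) := by
        have : Tendsto (fun s : ℝ => s ^ (N + 1)) (𝓝 0) (𝓝 (0 ^ (N + 1))) :=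
          (continuous_pow (N + 1)).tendsto 0
        rw [zero_pow (Nat.succ_ne_zero N)] at this
        exact this.mono_left nhdsWithin_le_nhds
      have h2 := hlim.sub ((hQ.trans_tendsto h1).mono_left hd.le)
      refine tendsto_nhds_unique (Q.tendsto_eval_punctured.mono_left hd.le) ?_
      simpa using h2
    have hQpos : 0 < Q.eval 0 := by
      rw [hQ0]
      refine Finset.sum_pos' (fun i _ => hterm i) ⟨i, Finset.mem_univ i, ?_⟩
      rw [if_neg (hδZ _ (hZ i) hi).le.not_gt]
      exact mul_pos (hd.weight_pos i)
        (Real.rpow_pos_of_pos (lt_of_le_of_ne (hd.nonneg i) (Ne.symm hi)) a)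
    refine ⟨l', Q, hfam, hQpos.le, fun h0 => absurd h0 hQpos.ne', ?_⟩
    refine (hQ.trans (isBigO_pow_pow_punctured (Nat.le_succ N))).congr' ?_ EventuallyEq.rfl
    filter_upwards [self_mem_nhdsWithin] with s hs
    rw [hsplit s hs]
    ring

theorem IsSpectralFamily.isBigO_one (h : IsSpectralFamily w l) {a : ℝ} (ha : 0 < a) :
    (fun s => ∑ i, w s i * l s i ^ a) =O[𝓝[≠] 0] fun _ => (1 : ℝ) := by
  refine IsBigO.fun_sum fun i _ => ?_
  have h1 : (fun s => l s i) =O[𝓝[≠] 0] fun _ => (1 : ℝ) := by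
    refine h.isBigO_of_sum h.nonneg ?_ i
    obtain ⟨P, hP⟩ := h.moment 1 le_rfl 0
    simp only [pow_one, pow_zero] at hP
    exact (hP.add (P.tendsto_eval_punctured.isBigO_one ℝ)).congr_left fun s => by ring
  have h2 := (h.isBigO_weight i (𝓝[≠] 0)).mul
    (h1.rpow ha.le (Eventually.of_forall fun _ => zero_le_one))
  simpa using h2

/-- The generalized power series expansion of a weighted sum of powers of a spectral family. -/
theorem IsSpectralFamily.exists_expansion (h : IsSpectralFamily w l) {a : ℝ} (ha : 0 < a)
    (N K : ℕ) :
    ∃ (Q : ℕ → ℝ[X]), (∀ k, 0 ≤ (Q k).eval 0 ∧ ((Q k).eval 0 = 0 → Q k = 0)) ∧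
      ∃ g : ℝ → ℝ, g =O[𝓝[≠] 0] (fun _ => (1 : ℝ)) ∧
      (fun s => ∑ i, w s i * l s i ^ a - (∑ k ∈ Finset.range K, (|s| ^ (2 * a)) ^ k * (Q k).eval s +
        (|s| ^ (2 * a)) ^ K * g s)) =O[𝓝[≠] 0] fun s => s ^ N := by
  induction K generalizing l with
  | zero =>
    refine ⟨fun _ => 0, fun k => by simp, _, h.isBigO_one ha, ?_⟩
    simpa using isBigO_zero _ _
  | succ K ih =>
    obtain ⟨l', Q₀, hl', hQ₀, hQ₀', hO⟩ := h.exists_split ha N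
    obtain ⟨Q, hQ, g, hg, hO'⟩ := ih hl'
    refine ⟨fun k => Nat.casesOn k Q₀ Q, fun k => ?_, g, hg, ?_⟩
    · cases k with
      | zero => exact ⟨hQ₀, hQ₀'⟩
      | succ k => exact hQ k
    · have hb : (fun s : ℝ => |s| ^ (2 * a)) =O[𝓝[≠] 0] fun _ => (1 : ℝ) := by
        have : Tendsto (fun s : ℝ => |s| ^ (2 * a)) (𝓝 0) (𝓝 (|0| ^ (2 * a))) :=
          (continuous_abs.rpow_const fun _ => Or.inr (by positivity)).tendsto 0
        exact (this.mono_left nhdsWithin_le_nhds).isBigO_one ℝ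
      have h2 := hb.mul hO'
      simp only [one_mul] at h2
      refine (hO.add h2).congr_left fun s => ?_
      rw [Finset.sum_range_succ']
      change _ = _ - ((∑ k ∈ Finset.range K, (|s| ^ (2 * a)) ^ (k + 1) * (Q k).eval s +
        (|s| ^ (2 * a)) ^ 0 * Q₀.eval s) + _)
      simp only [pow_succ', mul_assoc, ← Finset.mul_sum, pow_zero, one_mul]
      ring

end SpectralFamilies

/-! ### Comparison of exponents and coefficients. -/

section Comparison

open Filter Topology Asymptotics Polynomial

theorem isLittleO_rpow_rpow_of_lt {x y : ℝ} (h : x < y) :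
    (fun s : ℝ => s ^ y) =o[𝓝[>] 0] fun s : ℝ => s ^ x := by
  rw [isLittleO_iff_tendsto']
  · have h1 : Tendsto (fun s : ℝ => s ^ (y - x)) (𝓝 0) (𝓝 (0 ^ (y - x))) :=
      (continuous_id.rpow_const fun _ => Or.inr (by linarith)).tendsto 0
    rw [Real.zero_rpow (by linarith)] at h1
    refine (h1.mono_left nhdsWithin_le_nhds).congr' ?_
    filter_upwards [self_mem_nhdsWithin] with s (hs : 0 < s)
    rw [Real.rpow_sub hs]
  · filter_upwards [self_mem_nhdsWithin] with s (hs : 0 < s) h0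
    exact absurd h0 (Real.rpow_pos_of_pos hs x).ne'

/-- Uniqueness of the coefficients of generalized polynomials with real exponents. -/
theorem Finsupp.eq_zero_of_isLittleO_rpow (φ : ℝ →₀ ℝ) (E : ℝ)
    (h : (fun s : ℝ => Finsupp.linearCombination ℝ (fun e => s ^ e) φ) =o[𝓝[>] 0]
      fun s : ℝ => s ^ E) {e : ℝ} (he : e ≤ E) : φ e = 0 := by
  by_contra hne
  -- The term of lowest exponent dominates all others as `s → 0⁺`.
  obtain ⟨m, hm, hmin⟩ := φ.support.exists_min_image id ⟨e, Finsupp.mem_support_iff.2 hne⟩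
  have hmE : m ≤ E := (hmin e (Finsupp.mem_support_iff.2 hne)).trans he
  have h1 : (fun s : ℝ => s ^ E) =O[𝓝[>] 0] fun s : ℝ => s ^ m := by
    rcases hmE.eq_or_lt with rfl | hlt
    · exact isBigO_refl _ _
    · exact (isLittleO_rpow_rpow_of_lt hlt).isBigO
  have h2 : (fun s : ℝ => ∑ x ∈ φ.support.erase m, φ x * s ^ x) =o[𝓝[>] 0]
      fun s : ℝ => s ^ m := by
    refine IsLittleO.fun_sum fun x hx => ?_
    obtain ⟨hxm, hx⟩ := Finset.mem_erase.1 hx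
    exact (isLittleO_rpow_rpow_of_lt (lt_of_le_of_ne (hmin x hx) (Ne.symm hxm))).const_mul_left _
  have h3 : (fun s : ℝ => φ m * s ^ m) =o[𝓝[>] 0] fun s : ℝ => s ^ m := by
    refine ((h.trans_isBigO h1).sub h2).congr_left fun s => ?_
    rw [Finsupp.linearCombination_apply, Finsupp.sum, ← Finset.add_sum_erase _ _ hm]
    simp
  have h4 : (fun s : ℝ => s ^ m) =o[𝓝[>] 0] fun s : ℝ => s ^ m :=
    (isLittleO_const_mul_left_iff (Finsupp.mem_support_iff.1 hm)).1 h3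
  refine isLittleO_irrefl ?_ h4
  refine Eventually.frequently ?_
  filter_upwards [self_mem_nhdsWithin] with s hs
  exact (Real.rpow_pos_of_pos hs m).ne'

theorem Polynomial.isBigO_eval_add_eval_neg (Q : ℝ[X]) :
    (fun s => Q.eval s + Q.eval (-s) - (2 * Q.coeff 0 + 2 * Q.coeff 2 * s ^ 2)) =O[𝓝[≠] 0]
      fun s : ℝ => s ^ 4 := by
  have h : X ^ 4 ∣ Q + Q.comp (C (-1) * X) - (C (2 * Q.coeff 0) + C (2 * Q.coeff 2) * X ^ 2) := by
    rw [X_pow_dvd_iff]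
    intro d hd
    simp only [coeff_sub, coeff_add, comp_C_mul_X_coeff, coeff_C_mul, coeff_X_pow, coeff_C]
    interval_cases d <;> simp <;> ring
  refine (isBigO_of_X_pow_dvd h).congr_left fun s => ?_
  simp

variable {ι : Type*} [Fintype ι] {w l : ℝ → ι → ℝ}

/-- Symmetrizing in `s` removes the odd coefficients of each `Q_k`, whose exponents `pk + 1` would
spoil the comparison. -/
theorem IsSpectralFamily.exists_even_expansion (h : IsSpectralFamily w l) {p : ℝ} (hp : 0 < p) :
    ∃ (K : ℕ) (c d : ℕ → ℝ), (∀ k, 0 ≤ c k ∧ (c k = 0 → d k = 0)) ∧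
      (fun s => (∑ i, w s i * l s i ^ (p / 2)) + (∑ i, w (-s) i * l (-s) i ^ (p / 2)) -
        ∑ k ∈ Finset.range K, (c k * s ^ (p * k) + d k * s ^ (p * k + 2))) =O[𝓝[>] 0]
          fun s : ℝ => s ^ (4 : ℝ) := by
  -- With `pK ≥ 4` the remainder `|s|^(pK) g(s)` is absorbed in `O(s⁴)`.
  obtain ⟨K, hK⟩ := exists_nat_ge (4 / p)
  obtain ⟨Q, hQ, g, hg, hO⟩ := h.exists_expansion (half_pos hp) 4 K
  refine ⟨K, fun k => 2 * (Q k).coeff 0, fun k => 2 * (Q k).coeff 2, fun k => ?_, ?_⟩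
  · simp only [coeff_zero_eq_eval_zero]
    refine ⟨by linarith [(hQ k).1], fun h0 => ?_⟩
    rw [(hQ k).2 (by linarith)]
    simp
  have hle : 𝓝[>] (0 : ℝ) ≤ 𝓝[≠] 0 := nhdsWithin_mono _ fun s hs => ne_of_gt hs
  have hneg : Tendsto (fun s : ℝ => -s) (𝓝[>] 0) (𝓝[≠] 0) := by
    refine tendsto_nhdsWithin_iff.2 ⟨?_, ?_⟩
    · have : Tendsto (fun s : ℝ => -s) (𝓝 0) (𝓝 (-0)) := continuous_neg.tendsto 0
      rw [neg_zero] at this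
      exact this.mono_left nhdsWithin_le_nhds
    · filter_upwards [self_mem_nhdsWithin] with s (hs : 0 < s)
      simpa using hs.ne'
  have hrem : ∀ u : ℝ → ℝ, u =O[𝓝[>] 0] (fun _ => (1 : ℝ)) →
      (fun s : ℝ => (s ^ p) ^ K * u s) =O[𝓝[>] 0] fun s : ℝ => s ^ 4 := by
    intro u hu
    have h1 : (fun s : ℝ => (s ^ p) ^ K) =O[𝓝[>] 0] fun s : ℝ => s ^ 4 := by
      have h2 : (4 : ℝ) ≤ p * K := by
        rw [div_le_iff₀ hp] at hK; linarith
      have h3 : (fun s : ℝ => s ^ (p * K)) =O[𝓝[>] 0] fun s : ℝ => s ^ (4 : ℝ) := by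
        rcases h2.eq_or_lt with h2 | h2
        · rw [← h2]
        · exact (isLittleO_rpow_rpow_of_lt h2).isBigO
      refine h3.congr' ?_ ?_
      · filter_upwards [self_mem_nhdsWithin] with s (hs : 0 < s)
        rw [Real.rpow_mul hs.le, Real.rpow_natCast]
      · exact Eventually.of_forall fun s => by norm_cast
    simpa using h1.mul hu
  have hcoef : (fun s : ℝ => ∑ k ∈ Finset.range K, (s ^ p) ^ k * ((Q k).eval s + (Q k).eval (-s) -
      (2 * (Q k).coeff 0 + 2 * (Q k).coeff 2 * s ^ 2))) =O[𝓝[>] 0] fun s : ℝ => s ^ 4 := by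
    refine IsBigO.fun_sum fun k _ => ?_
    have hb : (fun s : ℝ => (s ^ p) ^ k) =O[𝓝[>] 0] fun _ => (1 : ℝ) := by
      have : Tendsto (fun s : ℝ => (s ^ p) ^ k) (𝓝 0) (𝓝 ((0 ^ p) ^ k)) :=
        ((continuous_id.rpow_const fun _ => Or.inr hp.le).pow k).tendsto 0
      exact (this.mono_left nhdsWithin_le_nhds).isBigO_one ℝ
    simpa using hb.mul ((Q k).isBigO_eval_add_eval_neg.mono hle)
  have hO2 := (hO.comp_tendsto hneg).congr_right (g₂ := fun s : ℝ => s ^ 4)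
    fun s => by simp [Even.neg_pow (show Even 4 by decide)]
  have hg2 : (fun s => g (-s)) =O[𝓝[>] 0] fun _ => (1 : ℝ) := hg.comp_tendsto hneg
  have hall := (((hO.mono hle).add hO2).add hcoef).add
    ((hrem g (hg.mono hle)).add (hrem _ hg2))
  refine hall.congr' ?_ ?_
  · filter_upwards [self_mem_nhdsWithin] with s (hs : 0 < s)
    have hsum : ∑ k ∈ Finset.range K, (2 * (Q k).coeff 0 * s ^ (p * k) +
        2 * (Q k).coeff 2 * s ^ (p * k + 2)) =
        ∑ k ∈ Finset.range K, (s ^ p) ^ k * (2 * (Q k).coeff 0 + 2 * (Q k).coeff 2 * s ^ 2) := by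
      refine Finset.sum_congr rfl fun k _ => ?_
      rw [Real.rpow_add hs, Real.rpow_mul hs.le, Real.rpow_natCast, Real.rpow_two]
      ring
    have h2 : 2 * (p / 2) = p := by ring
    simp only [Function.comp_apply, hsum, h2, abs_neg, abs_of_pos hs, mul_sub, mul_add,
      Finset.sum_sub_distrib, Finset.sum_add_distrib]
    ring
  · filter_upwards [self_mem_nhdsWithin] with s (hs : 0 < s)
    norm_cast

theorem Real.one_add_rpow_isBigO_cube (b : ℝ) :
    (fun u : ℝ => (1 + u) ^ b - (1 + b * u + b * (b - 1) / 2 * u ^ 2)) =O[𝓝 0]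
      fun u => u ^ 3 := by
  have h := (Real.one_add_rpow_hasFPowerSeriesAt_zero (a := b)).isBigO_sub_partialSum_pow 3
  have h2 : (fun y : ℝ => ‖y‖ ^ 3) =O[𝓝 0] fun y => y ^ 3 := isBigO_of_le _ fun y => by simp
  refine (h.trans h2).congr_left fun u => ?_
  simp only [FormalMultilinearSeries.partialSum, FormalMultilinearSeries.apply_eq_pow_smul_coeff,
    Finset.sum_range_succ, Finset.sum_range_zero, zero_add]
  have h3 : b * (b - 1) = 2 * Ring.choose b 2 := by
    have := Ring.descPochhammer_eq_factorial_smul_choose b 2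
    rw [← aeval_eq_smeval] at this
    simpa [descPochhammer] using this
  simp [binomialSeries, FormalMultilinearSeries.coeff_ofScalars, h3]
  ring

/-- The generalized polynomial with terms `c k * s ^ (p * k) + d k * s ^ (p * k + 2)`. -/
noncomputable def evenExpansion (p : ℝ) (K : ℕ) (c d : ℕ → ℝ) : ℝ →₀ ℝ :=
  ∑ k ∈ Finset.range K, (Finsupp.single (p * k) (c k) + Finsupp.single (p * k + 2) (d k))

theorem linearCombination_evenExpansion (p : ℝ) (K : ℕ) (c d : ℕ → ℝ) (s : ℝ) :
    Finsupp.linearCombination ℝ (fun e => s ^ e) (evenExpansion p K c d) =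
      ∑ k ∈ Finset.range K, (c k * s ^ (p * k) + d k * s ^ (p * k + 2)) := by
  simp [evenExpansion, map_sum]

theorem evenExpansion_apply (p : ℝ) (K : ℕ) (c d : ℕ → ℝ) (e : ℝ) :
    evenExpansion p K c d e = ∑ k ∈ Finset.range K,
      ((if p * k = e then c k else 0) + if p * k + 2 = e then d k else 0) := by
  classical
  simp [evenExpansion, Finsupp.finsetSum_apply, Finsupp.single_apply]

theorem exists_of_evenExpansion_ne_zero {p : ℝ} {K : ℕ} {c d : ℕ → ℝ} {e : ℝ} (hp : 0 < p)
    (he : e < 2) (h : evenExpansion p K c d e ≠ 0) : ∃ k : ℕ, p * k = e := by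
  by_contra! hne
  apply h
  rw [evenExpansion_apply]
  refine Finset.sum_eq_zero fun k _ => ?_
  have : (0 : ℝ) ≤ p * k := by positivity
  rw [if_neg (hne k), if_neg (by linarith), add_zero]

/-- As `2q < 4`, all coefficients up to the exponent `2q` can be compared with the binomial series.
The coefficient `2p/q` of `s^q` is nonzero, and the sign of the coefficient of `s^(2q)` decides the
second claim. -/
theorem exponents_of_schatten_expansion {p q : ℝ} (hp : 0 < p) (hq : 0 < q) (hq2 : q < 2) {K : ℕ}
    {c d : ℕ → ℝ} (hcd : ∀ k, 0 ≤ c k ∧ (c k = 0 → d k = 0))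
    (hO : (fun s : ℝ => 2 * (1 + s ^ q) ^ (p / q) -
      ∑ k ∈ Finset.range K, (c k * s ^ (p * k) + d k * s ^ (p * k + 2))) =O[𝓝[>] 0]
        fun s : ℝ => s ^ (4 : ℝ)) :
    (∃ k : ℕ, 1 ≤ k ∧ p * k = q) ∧ (q ≤ p ∨ q = 1) := by
  set b := p / q with hb
  have hbpos : 0 < b := div_pos hp hq
  set φ : ℝ →₀ ℝ := Finsupp.single 0 2 + Finsupp.single q (2 * b) +
    Finsupp.single (2 * q) (b * (b - 1)) - evenExpansion p K c d with hφ
  have hqt : Tendsto (fun s : ℝ => s ^ q) (𝓝[>] 0) (𝓝 0) := by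
    have : Tendsto (fun s : ℝ => s ^ q) (𝓝 0) (𝓝 (0 ^ q)) :=
      (continuous_id.rpow_const fun _ => Or.inr hq.le).tendsto 0
    rw [Real.zero_rpow hq.ne'] at this
    exact this.mono_left nhdsWithin_le_nhds
  have h1 : (fun s : ℝ => (1 + s ^ q) ^ b - (1 + b * s ^ q + b * (b - 1) / 2 * (s ^ q) ^ 2))
      =o[𝓝[>] 0] fun s : ℝ => s ^ (2 * q) := by
    refine ((Real.one_add_rpow_isBigO_cube b).comp_tendsto hqt).trans_isLittleO ?_
    refine (isLittleO_rpow_rpow_of_lt (show 2 * q < 3 * q by linarith)).congr' ?_ EventuallyEq.rfl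
    filter_upwards [self_mem_nhdsWithin] with s (hs : 0 < s)
    rw [mul_comm 3 q, Real.rpow_mul hs.le]
    norm_cast
  have h2 : (fun s : ℝ => Finsupp.linearCombination ℝ (fun e => s ^ e) φ) =o[𝓝[>] 0]
      fun s : ℝ => s ^ (2 * q) := by
    refine ((hO.trans_isLittleO (isLittleO_rpow_rpow_of_lt (show 2 * q < 4 by linarith))).sub
      (h1.const_mul_left 2)).congr' ?_ EventuallyEq.rfl
    filter_upwards [self_mem_nhdsWithin] with s (hs : 0 < s)
    simp only [hφ, map_sub, map_add, linearCombination_evenExpansion,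
      Finsupp.linearCombination_single, smul_eq_mul, Real.rpow_zero]
    rw [mul_comm 2 q, Real.rpow_mul hs.le, Real.rpow_two]
    ring
  have hcoef : ∀ e, 0 < e → e ≤ 2 * q → evenExpansion p K c d e =
      (if q = e then 2 * b else 0) + if 2 * q = e then b * (b - 1) else 0 := by
    intro e he he2
    have := φ.eq_zero_of_isLittleO_rpow _ h2 he2
    rw [hφ] at this
    simp only [Finsupp.coe_sub, Finsupp.coe_add, Pi.sub_apply, Pi.add_apply,
      Finsupp.single_apply, he.ne, if_false, zero_add] at this
    linarith
  have hfirst : ∃ k : ℕ, 1 ≤ k ∧ p * k = q := by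
    have h3 := hcoef q hq (by linarith)
    rw [if_pos rfl, if_neg (by linarith), add_zero] at h3
    obtain ⟨k, hk⟩ := exists_of_evenExpansion_ne_zero hp hq2 (by rw [h3]; positivity)
    refine ⟨k, Nat.one_le_iff_ne_zero.2 ?_, hk⟩
    rintro rfl
    simp at hk
    linarith
  refine ⟨hfirst, ?_⟩
  by_contra! hne
  obtain ⟨hpq, hq1⟩ := hne
  have hblt : b < 1 := (div_lt_one hq).2 hpq
  have h4 := hcoef (2 * q) (by linarith) le_rfl
  rw [if_neg (by linarith), if_pos rfl, zero_add, evenExpansion_apply] at h4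
  have h5 : ∑ k ∈ Finset.range K, ((if p * k = 2 * q then c k else 0) +
      if p * k + 2 = 2 * q then d k else 0) < ∑ k ∈ Finset.range K, (0 : ℝ) := by
    rw [h4, Finset.sum_const_zero]
    exact mul_neg_of_pos_of_neg hbpos (by linarith)
  obtain ⟨k, hkK, hk⟩ := Finset.exists_lt_of_sum_lt h5
  have hck : 0 ≤ if p * (k : ℝ) = 2 * q then c k else 0 := by
    split_ifs
    exacts [(hcd k).1, le_rfl]
  -- A negative contribution cannot come from `c k ≥ 0`, so it comes from `d k`.
  have hpk : p * k + 2 = 2 * q := by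
    by_contra h
    rw [if_neg h] at hk
    linarith
  rw [if_pos hpk] at hk
  have hk0 : k ≠ 0 := by
    rintro rfl
    apply hq1
    simp at hpk
    linarith
  have hckpos : 0 < c k := lt_of_le_of_ne (hcd k).1 fun h => by
    rw [(hcd k).2 h.symm] at hk
    linarith
  have hkpos : 0 < p * k := mul_pos hp (by positivity)
  -- Here `0 < pk = 2q - 2 < q`, so the binomial side has no such term, while `c k > 0`; no `d j`
  -- can cancel it, because `pk < 2`.
  have h6 := hcoef (p * k) hkpos (by linarith)
  rw [if_neg (by linarith), if_neg (by linarith), add_zero, evenExpansion_apply] at h6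
  have h7 : 0 < ∑ j ∈ Finset.range K, ((if p * (j : ℝ) = p * k then c j else 0) +
      if p * (j : ℝ) + 2 = p * k then d j else 0) := by
    refine Finset.sum_pos' (fun j _ => ?_) ⟨k, hkK, ?_⟩
    · have : (0 : ℝ) ≤ p * j := by positivity
      rw [if_neg (show ¬ p * (j : ℝ) + 2 = p * k by linarith), add_zero]
      split_ifs
      exacts [(hcd j).1, le_rfl]
    · rw [if_pos rfl, if_neg (by linarith), add_zero]
      exact hckpos
  linarith

theorem exponents_of_max_expansion {p : ℝ} (hp : 0 < p) {K : ℕ} {c d : ℕ → ℝ}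
    (hO : (fun s : ℝ => (1 + (1 + s) ^ p) -
      ∑ k ∈ Finset.range K, (c k * s ^ (p * k) + d k * s ^ (p * k + 2))) =O[𝓝[>] 0]
        fun s : ℝ => s ^ (4 : ℝ)) :
    ∃ k : ℕ, 1 ≤ k ∧ p * k = 1 := by
  set φ : ℝ →₀ ℝ := Finsupp.single 0 2 + Finsupp.single 1 p - evenExpansion p K c d with hφ
  have h1 : (fun s : ℝ => (1 + s) ^ p - (1 + p * s)) =o[𝓝[>] 0] fun s : ℝ => s ^ (1 : ℝ) := by
    have h : HasDerivAt (fun s : ℝ => (1 + s) ^ p) p 0 := by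
      have := ((hasDerivAt_id (0 : ℝ)).const_add 1).rpow_const (p := p) (Or.inl (by simp))
      simpa using this
    refine (h.isLittleO.mono nhdsWithin_le_nhds).congr ?_ ?_
    · intro s
      simp
      ring
    · intro s
      simp
  have h2 : (fun s : ℝ => Finsupp.linearCombination ℝ (fun e => s ^ e) φ) =o[𝓝[>] 0]
      fun s : ℝ => s ^ (1 : ℝ) := by
    refine ((hO.trans_isLittleO (isLittleO_rpow_rpow_of_lt (show (1 : ℝ) < 4 by norm_num))).sub
      h1).congr_left fun s => ?_
    simp only [hφ, map_sub, map_add, linearCombination_evenExpansion,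
      Finsupp.linearCombination_single, smul_eq_mul, Real.rpow_zero, Real.rpow_one]
    ring
  have h3 := φ.eq_zero_of_isLittleO_rpow _ h2 le_rfl
  rw [hφ] at h3
  simp only [Finsupp.coe_sub, Finsupp.coe_add, Pi.sub_apply, Pi.add_apply,
    Finsupp.single_apply, zero_ne_one, if_false, zero_add, if_true] at h3
  obtain ⟨k, hk⟩ := exists_of_evenExpansion_ne_zero hp (show (1 : ℝ) < 2 by norm_num)
    (show evenExpansion p K c d 1 ≠ 0 by linarith)
  refine ⟨k, Nat.one_le_iff_ne_zero.2 ?_, hk⟩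
  rintro rfl
  simp at hk

end Comparison

/-! ### Finiteness of the trace and its linear extension. -/

section Traces

open Filter Topology Asymptotics Polynomial

variable {M : Type*} [CStarAlgebra M] [PartialOrder M] [StarOrderedRing M]

theorem CStarAlgebra.mul_eq_zero_of_conjugate_eq_zero {y m : M} (hy : 0 ≤ y)
    (h : star m * y * m = 0) : y * m = 0 := by
  have hs : CFC.sqrt y * CFC.sqrt y = y := CFC.sqrt_mul_sqrt_self y hy
  have hsa : star (CFC.sqrt y) = CFC.sqrt y := (CFC.sqrt_nonneg y).isSelfAdjoint
  have h1 : CFC.sqrt y * m = 0 := by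
    rw [← CStarRing.star_mul_self_eq_zero_iff, star_mul, hsa, ← h]
    nth_rewrite 3 [← hs]
    noncomm_ring
  rw [← hs, mul_assoc, h1, mul_zero]

namespace IsNSFTrace

variable {τ : {x : M // 0 ≤ x} → ℝ≥0∞}

theorem map_zero (hτ : IsNSFTrace τ) : τ 0 = 0 := by
  have h : (⟨((0 : ℝ≥0) : ℝ) • ((0 : {x : M // 0 ≤ x}) : M), smul_nonneg (NNReal.coe_nonneg 0)
      (0 : {x : M // 0 ≤ x}).2⟩ : {x : M // 0 ≤ x}) = 0 := Subtype.ext (by simp)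
  have := hτ.map_smul 0 0
  rwa [h, ENNReal.coe_zero, zero_mul] at this

theorem mono (hτ : IsNSFTrace τ) {x y : {x : M // 0 ≤ x}} (h : x ≤ y) : τ x ≤ τ y := by
  have hz : (0 : M) ≤ (y : M) - x := sub_nonneg.2 h
  have : y = x + ⟨(y : M) - x, hz⟩ := Subtype.ext (by simp)
  rw [this, hτ.map_add]
  exact le_self_add

/-- Among positive elements of finite trace, one with smallest kernel is invertible: semifiniteness
below `m m⋆`, for a nonzero `m` in the kernel, would give a nonzero positive `z` of finite trace
with `yz = 0`, and `y + z` would have a smaller kernel. -/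
theorem exists_isUnit [FiniteDimensional ℂ M] (hτ : IsNSFTrace τ) :
    ∃ y : {x : M // 0 ≤ x}, IsUnit (y : M) ∧ τ y < ∞ := by
  let d : {x : M // 0 ≤ x} → ℕ := fun y =>
    Module.finrank ℂ (LinearMap.ker (LinearMap.mulLeft ℂ (y : M)))
  obtain ⟨y, hy, hmin⟩ : ∃ y, τ y < ∞ ∧ ∀ z, τ z < ∞ → d y ≤ d z := by
    have hne : {y | τ y < ∞}.Nonempty := ⟨0, by simp [hτ.map_zero]⟩
    exact ⟨Function.argminOn d _ hne, Function.argminOn_mem d _ hne,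
      fun z hz => Function.argminOn_le d _ hz⟩
  refine ⟨y, ?_, hy⟩
  have hker : LinearMap.ker (LinearMap.mulLeft ℂ (y : M)) = ⊥ := by
    by_contra hne
    obtain ⟨m, hm, hm0⟩ := Submodule.exists_mem_ne_zero_of_ne_bot hne
    have hym : (y : M) * m = 0 := by simpa using hm
    have hz0 : m * star m ≠ 0 := fun h => hm0 (CStarRing.mul_star_self_eq_zero_iff m |>.1 h)
    obtain ⟨z, hzle, hzne, hzτ⟩ := hτ.semifinite ⟨m * star m, mul_star_self_nonneg m⟩ hz0
    have hysa : star (y : M) = y := y.2.isSelfAdjoint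
    have hzsa : star (z : M) = z := z.2.isSelfAdjoint
    have hzy : (z : M) * y = 0 := by
      refine CStarAlgebra.mul_eq_zero_of_conjugate_eq_zero z.2 (le_antisymm ?_ ?_)
      · have h1 := star_left_conjugate_le_conjugate (show (z : M) ≤ m * star m from hzle) (y : M)
        refine h1.trans (le_of_eq ?_)
        rw [hysa, ← mul_assoc (y : M), hym]
        simp
      · exact star_left_conjugate_nonneg z.2 _
    have hyz : (y : M) * z = 0 := by
      have := congrArg star hzy
      rwa [star_mul, hysa, hzsa, star_zero] at this
    have hlt : LinearMap.ker (LinearMap.mulLeft ℂ ((y + z : {x : M // 0 ≤ x}) : M)) <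
        LinearMap.ker (LinearMap.mulLeft ℂ (y : M)) := by
      refine SetLike.lt_iff_le_and_exists.2 ⟨fun k hk => ?_, (z : M), by simpa using hyz, fun h => ?_⟩
      · have hk' : ((y : M) + z) * k = 0 := by simpa using hk
        have h1 : star k * y * k + star k * z * k = 0 := by
          rw [← add_mul, ← mul_add, mul_assoc, hk', mul_zero]
        have h2 := (add_eq_zero_iff_of_nonneg (star_left_conjugate_nonneg y.2 k)
          (star_left_conjugate_nonneg z.2 k)).1 h1
        simpa using CStarAlgebra.mul_eq_zero_of_conjugate_eq_zero y.2 h2.1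
      · have h1 : ((y : M) + z) * z = 0 := by simpa using h
        rw [add_mul, hyz, zero_add] at h1
        exact hzne ((CStarRing.star_mul_self_eq_zero_iff (z : M)).1 (by rw [hzsa, h1]))
    have := Submodule.finrank_lt_finrank_of_lt hlt
    have h2 := hmin (y + z) (by rw [hτ.map_add]; exact ENNReal.add_lt_top.2 ⟨hy, hzτ⟩)
    simp only [d] at h2
    omega
  have hsurj := (LinearMap.injective_iff_surjective (f := LinearMap.mulLeft ℂ (y : M))).1
    (LinearMap.ker_eq_bot.1 hker)
  obtain ⟨b, hb⟩ := hsurj 1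
  have hb' : (y : M) * b = 1 := by simpa using hb
  have hb2 : star b * y = 1 := by
    have := congrArg star hb'
    rwa [star_mul, y.2.isSelfAdjoint.star_eq, star_one] at this
  exact isUnit_iff_exists.2 ⟨b, hb', by
    rw [← left_inv_eq_right_inv hb2 hb']; exact hb2⟩

/-- A positive invertible element of finite trace is bounded below by a positive scalar, so a
multiple of it dominates `x`. -/
theorem ne_top [FiniteDimensional ℂ M] (hτ : IsNSFTrace τ) (x : {x : M // 0 ≤ x}) : τ x ≠ ∞ := by
  obtain ⟨y, hyu, hy⟩ := hτ.exists_isUnit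
  rcases subsingleton_or_nontrivial M with hM | hM
  · rw [show x = 0 from Subtype.ext (Subsingleton.elim _ _), hτ.map_zero]
    exact ENNReal.zero_ne_top
  obtain ⟨r, hr, hry⟩ := (CFC.exists_pos_algebraMap_le_iff (A := M) y.2.isSelfAdjoint).2
    fun t ht => lt_of_le_of_ne (spectrum_nonneg_of_nonneg y.2 ht) fun h => by
      subst h
      exact spectrum.zero_notMem ℝ hyu ht
  have h1 : (x : M) ≤ (Real.toNNReal (‖(x : M)‖ / r) : ℝ) • (y : M) := by
    rw [Real.coe_toNNReal _ (by positivity)]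
    calc (x : M) ≤ algebraMap ℝ M ‖(x : M)‖ := x.2.isSelfAdjoint.le_algebraMap_norm_self
      _ = (‖(x : M)‖ / r) • algebraMap ℝ M r := by
        rw [Algebra.smul_def, ← map_mul, div_mul_cancel₀ _ hr.ne']
      _ ≤ _ := smul_le_smul_of_nonneg_left hry (by positivity)
  have h2 := hτ.mono (x := x) (y := ⟨_, smul_nonneg (NNReal.coe_nonneg _) y.2⟩) h1
  rw [hτ.map_smul] at h2
  exact ne_top_of_le_ne_top (ENNReal.mul_ne_top ENNReal.coe_ne_top hy.ne) h2

end IsNSFTrace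

/-- An additive, positively homogeneous function on the positive cone extends to a real linear
functional. -/
theorem CStarAlgebra.exists_linearMap_extension (t : {x : M // 0 ≤ x} → ℝ)
    (hadd : ∀ x y, t (x + y) = t x + t y)
    (hsmul : ∀ (r : ℝ≥0) (x : {x : M // 0 ≤ x}),
      t ⟨(r : ℝ) • (x : M), smul_nonneg r.2 x.2⟩ = r * t x) :
    ∃ φ : M →ₗ[ℝ] ℝ, ∀ x : {x : M // 0 ≤ x}, φ x = t x := by
  let ψ : selfAdjoint M → ℝ := fun x =>
    t ⟨(x : M)⁺, CFC.posPart_nonneg _⟩ - t ⟨(x : M)⁻, CFC.negPart_nonneg _⟩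
  -- Any decomposition into positive elements may replace the Jordan decomposition; linearity
  -- follows from this.
  have hψ : ∀ (x : selfAdjoint M) (a b : {x : M // 0 ≤ x}), (x : M) = a - b →
      ψ x = t a - t b := by
    intro x a b h
    have h1 : (⟨(x : M)⁺, CFC.posPart_nonneg _⟩ + b : {x : M // 0 ≤ x}) =
        a + ⟨(x : M)⁻, CFC.negPart_nonneg _⟩ := by
      refine Subtype.ext ?_
      have h2 := CFC.posPart_sub_negPart (x : M) x.2
      rw [h] at h2
      simp only [Nonneg.coe_add, h]
      rw [sub_eq_sub_iff_add_eq_add] at h2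
      exact h2
    have h2 := congrArg t h1
    rw [hadd, hadd] at h2
    simp only [ψ]
    linarith
  have hdec : ∀ x : selfAdjoint M, ((x : M)⁺ - (x : M)⁻) = x := fun x =>
    CFC.posPart_sub_negPart (x : M) x.2
  let Ψ : selfAdjoint M →ₗ[ℝ] ℝ :=
    { toFun := ψ
      map_add' := fun x y => by
        rw [hψ (x + y) (⟨(x : M)⁺, CFC.posPart_nonneg _⟩ + ⟨(y : M)⁺, CFC.posPart_nonneg _⟩)
          (⟨(x : M)⁻, CFC.negPart_nonneg _⟩ + ⟨(y : M)⁻, CFC.negPart_nonneg _⟩), hadd, hadd]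
        · simp only [ψ]; ring
        · simp only [Nonneg.coe_add, AddSubgroup.coe_add]
          nth_rewrite 1 [← hdec x, ← hdec y]
          abel
      map_smul' := fun r x => by
        simp only [RingHom.id_apply, smul_eq_mul]
        rcases le_total 0 r with hr | hr
        · lift r to ℝ≥0 using hr
          rw [hψ _ ⟨(r : ℝ) • (x : M)⁺, smul_nonneg r.2 (CFC.posPart_nonneg _)⟩
            ⟨(r : ℝ) • (x : M)⁻, smul_nonneg r.2 (CFC.negPart_nonneg _)⟩,
            hsmul r ⟨(x : M)⁺, CFC.posPart_nonneg _⟩, hsmul r ⟨(x : M)⁻, CFC.negPart_nonneg _⟩]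
          · simp only [ψ]; ring
          · simp only [selfAdjoint.val_smul]
            rw [← smul_sub, hdec]
        · obtain ⟨r', rfl⟩ : ∃ r' : ℝ≥0, r = -r' := ⟨Real.toNNReal (-r), by
            rw [Real.coe_toNNReal _ (by linarith), neg_neg]⟩
          rw [hψ _ ⟨(r' : ℝ) • (x : M)⁻, smul_nonneg r'.2 (CFC.negPart_nonneg _)⟩
            ⟨(r' : ℝ) • (x : M)⁺, smul_nonneg r'.2 (CFC.posPart_nonneg _)⟩,
            hsmul r' ⟨(x : M)⁺, CFC.posPart_nonneg _⟩, hsmul r' ⟨(x : M)⁻, CFC.negPart_nonneg _⟩]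
          · simp only [ψ]; ring
          · simp only [selfAdjoint.val_smul]
            rw [← smul_sub, ← neg_sub, hdec, smul_neg, neg_smul] }
  refine ⟨Ψ.comp realPart, fun x => ?_⟩
  have h0 : t 0 = 0 := by simpa using hadd 0 0
  have h1 : ((realPart (x : M) : selfAdjoint M) : M) = (x : M) - ((0 : {x : M // 0 ≤ x}) : M) := by
    simp [x.2.isSelfAdjoint.coe_realPart]
  change ψ (realPart (x : M)) = t x
  rw [hψ _ x 0 h1, h0, sub_zero]

end Traces

/-! ### The `L_p`-norm along an affine line as a spectral sum. -/

section LpNorms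

open Filter Topology Asymptotics Polynomial

/-- The spectrum consists of roots of the minimal polynomial. The bound does not depend on `x`, so
one index type serves all parameters `s`. -/
theorem spectrum_real_finite_card {M : Type*} [CStarAlgebra M] [FiniteDimensional ℂ M] (x : M) :
    ∃ S : Finset ℝ, (S : Set ℝ) = spectrum ℝ x ∧ S.card ≤ Module.finrank ℝ M := by
  classical
  have hint : IsIntegral ℝ x := Algebra.IsIntegral.isIntegral x
  have hne : minpoly ℝ x ≠ 0 := minpoly.ne_zero hint
  have hsub : spectrum ℝ x ⊆ ((minpoly ℝ x).roots.toFinset : Set ℝ) := by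
    intro t ht
    have h1 : (minpoly ℝ x).eval t ∈ spectrum ℝ (aeval x (minpoly ℝ x)) :=
      spectrum.subset_polynomial_aeval x _ ⟨t, ht, rfl⟩
    rw [minpoly.aeval] at h1
    have : Nontrivial M := by
      by_contra h
      rw [not_nontrivial_iff_subsingleton] at h
      rw [spectrum.of_subsingleton] at h1
      exact h1
    rw [spectrum.zero_eq] at h1
    simpa [hne] using h1
  have hfin : (spectrum ℝ x).Finite := (Finset.finite_toSet _).subset hsub
  refine ⟨hfin.toFinset, hfin.coe_toFinset, ?_⟩
  refine (Finset.card_le_card fun t ht => ?_).trans ((Multiset.toFinset_card_le _).trans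
    ((card_roots' _).trans (minpoly.natDegree_le x)))
  exact Finset.mem_coe.1 (hsub (hfin.mem_toFinset.1 ht))

variable {M : Type*} [CStarAlgebra M] [PartialOrder M] [StarOrderedRing M]

theorem CFC.abs_rpow_eq (x : M) {p : ℝ} (hp : 0 < p) :
    CFC.abs x ^ p = cfc (fun t : ℝ => t ^ (p / 2)) (star x * x) := by
  rw [CFC.abs, CFC.sqrt_eq_rpow,
    CFC.rpow_rpow_of_exponent_nonneg _ _ _ (by norm_num) hp.le (star_mul_self_nonneg x),
    CFC.rpow_eq_cfc_real (star_mul_self_nonneg x)]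
  congr 2
  ext
  congr 1
  ring

variable [FiniteDimensional ℂ M]

/-- A functional with `w₀ ‖x‖ ≤ φ x ≤ W ‖x‖` on the positive cone, evaluated on the functional
calculus of a positive element, is a weighted sum over the spectrum. -/
theorem exists_spectral_weights {φ : M →ₗ[ℝ] ℝ} {w₀ W : ℝ} (hlow : ∀ x, 0 ≤ x → w₀ * ‖x‖ ≤ φ x)
    (hup : ∀ x, 0 ≤ x → φ x ≤ W * ‖x‖) {x : M} (hx : 0 ≤ x) :
    ∃ w l : Fin (Module.finrank ℝ M) → ℝ,
      (∀ i, 0 ≤ l i ∧ w₀ ≤ w i ∧ w i ≤ max w₀ W) ∧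
      ∀ f : ℝ → ℝ, f 0 = 0 → φ (cfc f x) = ∑ i, w i * f (l i) := by
  classical
  obtain ⟨S, hS, hcard⟩ := spectrum_real_finite_card x
  have hmem : ∀ y : S, (y : ℝ) ∈ spectrum ℝ x := fun y => hS ▸ y.2
  have hcont : ∀ f : ℝ → ℝ, ContinuousOn f (spectrum ℝ x) := fun f =>
    (hS ▸ S.finite_toSet : (spectrum ℝ x).Finite).continuousOn f
  have hsa : IsSelfAdjoint x := hx.isSelfAdjoint
  obtain ⟨e⟩ : Nonempty (S ↪ Fin (Module.finrank ℝ M)) :=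
    Function.Embedding.nonempty_of_card_le (by simpa using hcard)
  let P : ℝ → M := fun y => cfc (fun t => if t = y then (1 : ℝ) else 0) x
  have hP0 : ∀ y, 0 ≤ P y := fun y => cfc_nonneg fun t _ => by split_ifs <;> simp
  have hPnorm : ∀ y : S, ‖P y‖ = 1 := by
    intro y
    apply le_antisymm
    · exact norm_cfc_le zero_le_one fun t _ => by split_ifs <;> simp
    · have := norm_apply_le_norm_cfc (fun t => if t = (y : ℝ) then (1 : ℝ) else 0) x (hmem y)
        (hcont _)
      simpa using this
  -- The weights are the values of `φ` on spectral projections, which have norm `1`. Unused indices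
  -- get the point `0` and the harmless weight `w₀`; hence the condition `f 0 = 0`.
  refine ⟨Function.extend e (fun y => φ (P y)) fun _ => w₀,
    Function.extend e (fun y => (y : ℝ)) fun _ => 0, fun i => ?_, fun f hf => ?_⟩
  · by_cases hi : ∃ y, e y = i
    · obtain ⟨y, rfl⟩ := hi
      simp only [e.injective.extend_apply]
      have h1 := hlow _ (hP0 y)
      have h2 := hup _ (hP0 y)
      rw [hPnorm, mul_one] at h1 h2
      exact ⟨spectrum_nonneg_of_nonneg hx (hmem y), h1, h2.trans (le_max_right _ _)⟩
    · simp only [Function.extend_apply' _ _ _ hi]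
      exact ⟨le_rfl, le_rfl, le_max_left _ _⟩
  · have h1 : cfc f x = ∑ y ∈ S, f y • P y := by
      have h2 : (spectrum ℝ x).EqOn f
          (∑ y ∈ S, fun t => f y • if t = y then (1 : ℝ) else 0) := by
        intro t ht
        have htS : t ∈ S := by rw [← hS] at ht; exact ht
        simp [Finset.sum_apply, htS]
      rw [cfc_congr h2, cfc_sum _ _ _ fun _ _ => hcont _]
      refine Finset.sum_congr rfl fun y _ => ?_
      rw [cfc_smul _ _ _ (hcont _)]
    rw [h1, map_sum, ← Finset.sum_coe_sort]
    refine Fintype.sum_of_injective e e.injective _ _ (fun i hi => ?_) fun y => ?_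
    · rw [Function.extend_apply' (fun y : S => (y : ℝ)) _ _ hi, hf, mul_zero]
    · rw [e.injective.extend_apply, e.injective.extend_apply, map_smul, smul_eq_mul, mul_comm]

/-- In finite dimension the trace is given by a linear functional equivalent to the norm on the
positive cone. -/
theorem IsNSFTrace.exists_functional {τ : {x : M // 0 ≤ x} → ℝ≥0∞} (hτ : IsNSFTrace τ) :
    ∃ (φ : M →L[ℝ] ℝ) (w₀ W : ℝ), 0 < w₀ ∧ (∀ x, 0 ≤ x → w₀ * ‖x‖ ≤ φ x) ∧
      (∀ x, 0 ≤ x → φ x ≤ W * ‖x‖) ∧ ∀ x, τ x = ENNReal.ofReal (φ x) := by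
  have hadd : ∀ x y, (τ (x + y)).toReal = (τ x).toReal + (τ y).toReal := fun x y => by
    rw [hτ.map_add, ENNReal.toReal_add (hτ.ne_top x) (hτ.ne_top y)]
  have hsmul : ∀ (r : ℝ≥0) (x : {x : M // 0 ≤ x}),
      (τ ⟨(r : ℝ) • (x : M), smul_nonneg r.2 x.2⟩).toReal = r * (τ x).toReal := fun r x => by
    rw [hτ.map_smul r x, ENNReal.toReal_mul, ENNReal.coe_toReal]
  obtain ⟨ψ, hψ⟩ := CStarAlgebra.exists_linearMap_extension (fun x => (τ x).toReal) hadd hsmul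
  let φ : M →L[ℝ] ℝ := LinearMap.toContinuousLinearMap ψ
  have hφ : ∀ x, τ x = ENNReal.ofReal (φ x) := fun x => by
    change τ x = ENNReal.ofReal (ψ x)
    rw [hψ, ENNReal.ofReal_toReal (hτ.ne_top x)]
  have hpos : ∀ x : M, 0 ≤ x → x ≠ 0 → 0 < φ x := fun x hx hx0 => by
    by_contra h
    have := hφ ⟨x, hx⟩
    rw [ENNReal.ofReal_of_nonpos (not_lt.1 h)] at this
    exact hx0 (hτ.faithful _ this)
  have hup : ∀ x, 0 ≤ x → φ x ≤ ‖φ‖ * ‖x‖ := fun x _ =>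
    (le_abs_self _).trans (φ.le_opNorm x)
  have : ProperSpace M := FiniteDimensional.proper ℂ M
  have hcpt : IsCompact ({x : M | 0 ≤ x} ∩ Metric.sphere 0 1) :=
    (isCompact_sphere 0 1).inter_left (isClosed_Ici (a := (0 : M)))
  -- The lower constant is the minimum of `φ` over positive elements of norm `1`; if there are none,
  -- `0` is the only positive element.
  rcases ({x : M | 0 ≤ x} ∩ Metric.sphere 0 1).eq_empty_or_nonempty with he | hne
  · refine ⟨φ, 1, ‖φ‖, one_pos, fun x hx => ?_, hup, hφ⟩
    have hx0 : x = 0 := by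
      by_contra hx0
      have hn : ‖x‖ ≠ 0 := norm_ne_zero_iff.2 hx0
      have : ‖x‖⁻¹ • x ∈ ({x : M | 0 ≤ x} ∩ Metric.sphere 0 1) :=
        ⟨smul_nonneg (by positivity) hx, by simp [norm_smul, hn]⟩
      rw [he] at this
      exact this
    simp [hx0]
  · obtain ⟨x₀, hx₀, hmin⟩ := hcpt.exists_isMinOn hne φ.continuous.continuousOn
    have hx₀0 : x₀ ≠ 0 := by
      rintro rfl
      simpa using hx₀.2
    refine ⟨φ, φ x₀, ‖φ‖, hpos x₀ hx₀.1 hx₀0, fun x hx => ?_, hup, hφ⟩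
    by_cases hx0 : x = 0
    · simp [hx0]
    have hn : 0 < ‖x‖ := norm_pos_iff.2 hx0
    have h1 : φ x₀ ≤ φ (‖x‖⁻¹ • x) :=
      hmin ⟨smul_nonneg (by positivity) hx, by simp [norm_smul, hn.ne']⟩
    rw [_root_.map_smul, smul_eq_mul, inv_mul_eq_div, le_div_iff₀ hn] at h1
    exact h1

/-- The `L_p`-norms along a real affine line are given by a spectral family. -/
theorem IsNSFTrace.exists_isSpectralFamily {τ : {x : M // 0 ≤ x} → ℝ≥0∞} (hτ : IsNSFTrace τ)
    (A B : M) {p : ℝ} (hp : 0 < p) :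
    ∃ w l : ℝ → Fin (Module.finrank ℝ M) → ℝ, IsSpectralFamily w l ∧
      ∀ s : ℝ, ncLpNorm τ (ENNReal.ofReal p) (A + s • B) =
        ENNReal.ofReal (∑ i, w s i * l s i ^ (p / 2)) ^ (1 / p) := by
  obtain ⟨φ, w₀, W, hw₀, hlow, hup, hφ⟩ := hτ.exists_functional
  let H : ℝ → M := fun s => star (A + s • B) * (A + s • B)
  have hH : ∀ s, 0 ≤ H s := fun s => star_mul_self_nonneg _
  choose w l hwl hcfc using fun s =>
    exists_spectral_weights (φ := (φ : M →ₗ[ℝ] ℝ)) hlow hup (hH s)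
  refine ⟨w, l, ⟨fun s i => (hwl s i).1, ⟨w₀, hw₀, fun s i => (hwl s i).2.1⟩,
    ⟨max w₀ W, fun s i => (hwl s i).2.2⟩, fun r hr => ?_⟩, fun s => ?_⟩
  -- The moments are values of `φ` on powers of a polynomial in `s`, hence analytic, although the
  -- eigenvalues are chosen arbitrarily.
  · have h1 : ∀ s, ∑ i, w s i * l s i ^ r = φ (H s ^ r) := by
      intro s
      rw [← hcfc s (fun t => t ^ r) (by simp; omega), cfc_pow_id (H s) r (hH s).isSelfAdjoint]
      rfl
    simp only [h1]
    refine HasExpansion.of_analyticAt ?_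
    have h2 : ∀ s : ℝ, H s = (star A + s • star B) * (A + s • B) := fun s => by simp [H]
    simp only [h2]
    exact (φ.analyticAt _).comp (f := fun s : ℝ => ((star A + s • star B) * (A + s • B)) ^ r)
      (by fun_prop)
  · rw [ncLpNorm, if_neg ENNReal.ofReal_ne_top, hφ]
    simp only [ENNReal.toReal_ofReal hp.le]
    rw [CFC.abs_rpow_eq _ hp, ← hcfc s (fun t => t ^ (p / 2)) (Real.zero_rpow (by positivity))]
    rfl

end LpNorms

/-! ### Schatten norms of real diagonal operators. -/

section DiagonalOperators

open Filter Topology Asymptotics Polynomial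

/-- The diagonal operators with real entries. -/
noncomputable def diagonalOperator (m : ℕ) :
    (Fin m → ℝ) →ₐ[ℝ] (EuclideanSpace ℂ (Fin m) →L[ℂ] EuclideanSpace ℂ (Fin m)) :=
  ((Matrix.toEuclideanCLM (𝕜 := ℂ) (n := Fin m)).toAlgEquiv.toAlgHom.restrictScalars ℝ).comp
    ((Matrix.diagonalAlgHom ℝ (α := ℂ)).comp (Complex.ofRealAm.compLeft (Fin m)))

variable {m : ℕ}

theorem diagonalOperator_apply (d : Fin m → ℝ) :
    diagonalOperator m d = Matrix.toEuclideanCLM (𝕜 := ℂ) (Matrix.diagonal fun i => (d i : ℂ)) :=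
  rfl

theorem star_diagonalOperator (d : Fin m → ℝ) :
    star (diagonalOperator m d) = diagonalOperator m d := by
  rw [diagonalOperator_apply, ← map_star, Matrix.star_eq_conjTranspose,
    Matrix.diagonal_conjTranspose]
  congr 2
  ext i
  simp

theorem norm_diagonalOperator (d : Fin m → ℝ) : ‖diagonalOperator m d‖ = ‖d‖ := by
  rw [diagonalOperator_apply, ← Matrix.cstar_norm_def, Matrix.l2_opNorm_diagonal]
  simp [Pi.norm_def]

theorem trace_diagonalOperator (d : Fin m → ℝ) :
    LinearMap.trace ℂ (EuclideanSpace ℂ (Fin m))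
      (diagonalOperator m d : EuclideanSpace ℂ (Fin m) →ₗ[ℂ] EuclideanSpace ℂ (Fin m)) =
        ((∑ i, d i : ℝ) : ℂ) := by
  rw [diagonalOperator_apply, Matrix.coe_toEuclideanCLM_eq_toEuclideanLin,
    Matrix.toEuclideanLin_eq_toLin_orthonormal, Matrix.trace_toLin_eq, Matrix.trace_diagonal]
  simp

/-- On the finite spectrum `f` agrees with its Lagrange interpolant, and polynomials commute with
algebra homomorphisms. -/
theorem cfc_diagonalOperator (f : ℝ → ℝ) (d : Fin m → ℝ) :
    cfc f (diagonalOperator m d) = diagonalOperator m fun i => f (d i) := by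
  classical
  have hspec : spectrum ℝ (diagonalOperator m d) ⊆ Set.range d := by
    refine (AlgHom.spectrum_apply_subset _ _).trans ?_
    rw [Pi.spectrum_eq]
    refine Set.iUnion_subset fun i t ht => ⟨i, ?_⟩
    simpa [spectrum.mem_iff, sub_eq_zero, eq_comm] using ht
  obtain ⟨P, hP⟩ : ∃ P : ℝ[X], ∀ i, P.eval (d i) = f (d i) :=
    ⟨Lagrange.interpolate (Finset.univ.image d) id f, fun i =>
      Lagrange.eval_interpolate_at_node (v := id) f Function.injective_id.injOn
        (Finset.mem_image_of_mem d (Finset.mem_univ i))⟩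
  have hcongr : (spectrum ℝ (diagonalOperator m d)).EqOn f P.eval := by
    intro t ht
    obtain ⟨i, rfl⟩ := hspec ht
    exact (hP i).symm
  rw [cfc_congr hcongr, cfc_polynomial P _ (show IsSelfAdjoint _ from star_diagonalOperator d),
    aeval_algHom_apply]
  congr 1
  ext i
  rw [← hP i, ← coe_aeval_eq_eval]
  exact (aeval_algHom_apply (Pi.evalAlgHom ℝ (fun _ : Fin m => ℝ) i) d P).symm

theorem ncLpNorm_diagonalOperator (d : Fin m → ℝ) {q : ℝ} (hq : 0 < q) :
    ncLpNorm (usualTrace m) (ENNReal.ofReal q) (diagonalOperator m d) =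
      ENNReal.ofReal (∑ i, |d i| ^ q) ^ (1 / q) := by
  rw [ncLpNorm, if_neg ENNReal.ofReal_ne_top]
  simp only [usualTrace, ENNReal.toReal_ofReal hq.le]
  rw [CFC.abs_rpow_eq _ hq, star_diagonalOperator, ← map_mul, cfc_diagonalOperator,
    trace_diagonalOperator, Complex.ofReal_re]
  have h : ∀ i, (d * d) i ^ (q / 2) = |d i| ^ q := fun i => by
    rw [Pi.mul_apply, ← abs_mul_abs_self, Real.mul_rpow (abs_nonneg _) (abs_nonneg _),
      ← Real.rpow_add' (abs_nonneg _) (by linarith), add_halves]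
  simp only [h]

theorem sum_abs_single_add_single_rpow {i j : Fin m} (hij : i ≠ j) (t : ℝ) {q : ℝ} (hq : 0 < q) :
    ∑ k, |(Pi.single i 1 + t • Pi.single j 1 : Fin m → ℝ) k| ^ q = 1 + |t| ^ q := by
  rw [Finset.sum_eq_add i j hij]
  · simp [hij, hij.symm]
  · intro k _ hk
    simp [hk.1, hk.2, Real.zero_rpow hq.ne']
  · simp
  · simp

theorem norm_single_add_single {i j : Fin m} (hij : i ≠ j) (t : ℝ) :
    ‖(Pi.single i 1 + t • Pi.single j 1 : Fin m → ℝ)‖ = max 1 |t| := by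
  apply le_antisymm
  · refine (pi_norm_le_iff_of_nonneg (by positivity)).2 fun k => ?_
    by_cases hki : k = i
    · subst hki
      simp [hij]
    by_cases hkj : k = j
    · subst hkj
      simp [hij]
    · simp [hki, hkj]
  · refine max_le ?_ ?_
    · refine le_of_eq_of_le ?_ (norm_le_pi_norm _ i)
      simp [hij]
    · refine le_of_eq_of_le ?_ (norm_le_pi_norm _ j)
      simp [hij.symm]

end DiagonalOperators

/-! ### Necessary conditions on the exponents of an embedding. -/

section Embeddings

open Filter Topology Asymptotics Polynomial

variable {M : Type*} [CStarAlgebra M] [PartialOrder M] [StarOrderedRing M] [FiniteDimensional ℂ M]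
  {τ : {x : M // 0 ≤ x} → ℝ≥0∞} {p : ℝ} {m : ℕ}

/-- Restriction of an embedding to a line of diagonal operators. -/
theorem SchattenEmbedsInLp.exists_isSpectralFamily (hτ : IsNSFTrace τ) (hp : 0 < p) (hm : 2 ≤ m)
    {q : ℝ≥0∞} (h : SchattenEmbedsInLp m q τ (ENNReal.ofReal p)) (t₀ : ℝ) :
    ∃ (i j : Fin m) (w l : ℝ → Fin (Module.finrank ℝ M) → ℝ), i ≠ j ∧ IsSpectralFamily w l ∧
      ∀ s, ENNReal.ofReal (∑ k, w s k * l s k ^ (p / 2)) ^ (1 / p) =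
        ncLpNorm (usualTrace m) q
          (diagonalOperator m (Pi.single i 1 + (t₀ + s) • Pi.single j 1)) := by
  obtain ⟨T, hT⟩ := h
  let i : Fin m := ⟨0, by omega⟩
  let j : Fin m := ⟨1, by omega⟩
  let E := fun k => T (diagonalOperator m (Pi.single k 1))
  obtain ⟨w, l, hfam, hnorm⟩ := hτ.exists_isSpectralFamily (E i + t₀ • E j) (E j) hp
  refine ⟨i, j, w, l, by simp [i, j], hfam, fun s => ?_⟩
  rw [← hnorm, ← hT]
  congr 1
  simp only [E, map_add, map_smul, LinearMap.map_smul_of_tower]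
  rw [add_smul, add_assoc]

theorem SchattenEmbedsInLp.exponents (hτ : IsNSFTrace τ) (hp : 0 < p) (hm : 2 ≤ m) {q : ℝ}
    (hq : 0 < q) (hq2 : q < 2)
    (h : SchattenEmbedsInLp m (ENNReal.ofReal q) τ (ENNReal.ofReal p)) :
    (∃ k : ℕ, 1 ≤ k ∧ p * k = q) ∧ (q ≤ p ∨ q = 1) := by
  obtain ⟨i, j, w, l, hij, hfam, hnorm⟩ := h.exists_isSpectralFamily hτ hp hm 0
  have hF : ∀ s : ℝ, ∑ k, w s k * l s k ^ (p / 2) = (1 + |s| ^ q) ^ (p / q) := by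
    intro s
    have h1 := hnorm s
    have hpos : (0 : ℝ) < 1 + |s| ^ q := by positivity
    rw [ncLpNorm_diagonalOperator _ hq, sum_abs_single_add_single_rpow hij _ hq, zero_add] at h1
    have h2 := congrArg (fun x : ℝ≥0∞ => x ^ p) h1
    rw [← ENNReal.rpow_mul, ← ENNReal.rpow_mul, one_div_mul_cancel hp.ne', ENNReal.rpow_one,
      ENNReal.ofReal_rpow_of_pos hpos, one_div_mul_eq_div] at h2
    obtain ⟨w₀, hw₀, hw⟩ := hfam.weight_pos
    exact (ENNReal.ofReal_eq_ofReal_iff (Finset.sum_nonneg fun k _ =>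
      mul_nonneg (hw₀.le.trans (hw s k)) (Real.rpow_nonneg (hfam.nonneg s k) _))
      (Real.rpow_nonneg hpos.le _)).1 h2
  obtain ⟨K, c, d, hcd, hO⟩ := hfam.exists_even_expansion hp
  refine exponents_of_schatten_expansion hp hq hq2 hcd (K := K) (hO.congr' ?_ EventuallyEq.rfl)
  filter_upwards [self_mem_nhdsWithin] with s (hs : 0 < s)
  rw [hF, hF, abs_neg, abs_of_pos hs]
  ring

/-- The line is based at `t₀ = 1`, the kink of `max 1 |t|`: the two sides add up to `1 + (1 + s)^p`,
whose linear term survives symmetrization. -/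
theorem SchattenEmbedsInLp.exponent_of_top (hτ : IsNSFTrace τ) (hp : 0 < p) (hm : 2 ≤ m)
    (h : SchattenEmbedsInLp m ∞ τ (ENNReal.ofReal p)) : ∃ k : ℕ, 1 ≤ k ∧ p * k = 1 := by
  obtain ⟨i, j, w, l, hij, hfam, hnorm⟩ := h.exists_isSpectralFamily hτ hp hm 1
  have hF : ∀ s : ℝ, ∑ k, w s k * l s k ^ (p / 2) = (max 1 |1 + s|) ^ p := by
    intro s
    have h1 := hnorm s
    have hpos : (0 : ℝ) < max 1 |1 + s| := lt_max_of_lt_left one_pos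
    rw [ncLpNorm, if_pos rfl, norm_diagonalOperator, norm_single_add_single hij] at h1
    have h2 := congrArg (fun x : ℝ≥0∞ => x ^ p) h1
    rw [← ENNReal.rpow_mul, one_div_mul_cancel hp.ne', ENNReal.rpow_one,
      ENNReal.ofReal_rpow_of_pos hpos] at h2
    obtain ⟨w₀, hw₀, hw⟩ := hfam.weight_pos
    exact (ENNReal.ofReal_eq_ofReal_iff (Finset.sum_nonneg fun k _ =>
      mul_nonneg (hw₀.le.trans (hw s k)) (Real.rpow_nonneg (hfam.nonneg s k) _))
      (Real.rpow_nonneg hpos.le _)).1 h2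
  obtain ⟨K, c, d, -, hO⟩ := hfam.exists_even_expansion hp
  refine exponents_of_max_expansion hp (K := K) (c := c) (d := d) (hO.congr' ?_ EventuallyEq.rfl)
  filter_upwards [Ioo_mem_nhdsGT (show (0 : ℝ) < 1 by norm_num)] with s ⟨hs, hs1⟩
  have h1 : max 1 |1 + s| = 1 + s := by
    rw [abs_of_pos (by linarith)]
    exact max_eq_right (by linarith)
  have h2 : max 1 |1 + -s| = 1 := by
    rw [abs_of_pos (by linarith)]
    exact max_eq_left (by linarith)
  rw [hF, hF, h1, h2, Real.one_rpow]
  ring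

end Embeddings

theorem mainTheorem3 {M : Type*} [CStarAlgebra M] [WStarAlgebra M] [PartialOrder M]
    [StarOrderedRing M] [FiniteDimensional ℂ M] (hM : 2 ≤ Module.finrank ℂ M)
    (τ : {x : M // 0 ≤ x} → ℝ≥0∞) (hτ : IsNSFTrace τ)
    (p : ℝ) (hp0 : 0 < p) (hp1 : p < 1) (m : ℕ) (hm : 2 ≤ m) :
    (∀ q : ℝ, 0 < q → q < 2 → q ≠ 1 → q ≠ p →
      ¬ SchattenEmbedsInLp m (ENNReal.ofReal q) τ (ENNReal.ofReal p)) ∧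
    ((∀ k : ℕ, 1 ≤ k → p ≠ 1 / (k : ℝ)) →
      ¬ SchattenEmbedsInLp m 1 τ (ENNReal.ofReal p)) ∧
    ((∀ k : ℕ, 1 ≤ k → p ≠ 1 / (k : ℝ)) →
      ¬ SchattenEmbedsInLp m ∞ τ (ENNReal.ofReal p)) := by
  refine ⟨fun q hq hq2 hq1 hqp h => ?_, fun hk h => ?_, fun hk h => ?_⟩
  · obtain ⟨⟨k, hk, rfl⟩, hle⟩ := h.exponents hτ hp0 hm hq hq2
    rcases hle with hle | h1
    -- `q = pk` with `k ≥ 1` gives `p ≤ q`, so `q ≤ p` leaves only the excluded case `q = p`.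
    · refine hqp (le_antisymm hle (le_mul_of_one_le_right hp0.le ?_))
      exact_mod_cast hk
    · exact hq1 h1
  · rw [← ENNReal.ofReal_one] at h
    obtain ⟨⟨k, hk1, hpk⟩, -⟩ := h.exponents hτ hp0 hm one_pos one_lt_two
    exact hk k hk1 (eq_one_div_of_mul_eq_one_left hpk)
  · obtain ⟨k, hk1, hpk⟩ := h.exponent_of_top hτ hp0 hm
    exact hk k hk1 (eq_one_div_of_mul_eq_one_left hpk)
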